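/- For $f,g\colon\omega\to\omega$ say that $f$ dominates $g$, written $f\ge^* g$ or $g\le^* f$, if $\{n\in\omega : f(n)<g(n)\}$ is finite. A family $\mathcal F$ of functions $\omega\to\omega$ is a dominating family if every $g\colon\omega\to\omega$ is dominated by some $f\in\mathcal F$, and it is unbounded if no single function $\omega\to\omega$ dominates all of its members. Let $\mathfrak d$ be the least cardinality of a dominating family and $\mathfrak b$ the least cardinality of an unbounded family. Graphs are simple and undirected, of arbitrary cardinality. A ray in a graph $G$ with vertex set $X$ is an injective map $R\colon\omega\to X$ such that $R(n)$ and $R(n+1)$ are adjacent for all $n$. The graph $G$ is dominating if there is a labelling $L\colon X\to\omega$ such that for every $f\colon\omega\to\omega$ there is a ray $R$ in $G$ with $f\le^* L\circ R$. Let $T_\omega$ be the tree in which every vertex has countably infinite degree. A (nonempty) tree $T$ is a subdivision of $T_\omega$ if every vertex of $T$ has degree $2$ or countably infinite degree and every ray in $T$ contains a vertex that has infinite degree in $T$; the vertices of infinite degree are the branch vertices of $T$. A subdivided edge at a branch vertex $x$ is a path in $T$ from $x$ to another branch vertex that contains no branch vertices other than its two endvertices. The subdivision $T$ is uniform if it has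 a branch vertex $r$ such that, for every branch vertex $x$, all the subdivided edges at $x$ that are not contained in the unique path in $T$ from $x$ to $r$ have the same length. Subgraphs or rays are disjoint if they have no common vertex. **Theorem.** A graph $G$ is dominating if and only if at least one of the following three conditions holds: 1. $G$ contains a uniform subdivision of $T_\omega$ as a subgraph; 2. $G$ contains $\mathfrak b$ pairwise disjoint subdivisions of $T_\omega$ as subgraphs; 3. $G$ contains $\mathfrak d$ pairwise disjoint rays. -/

import Mathlib

namespace DominatingGraphs

universe u

/-- `Dominates f g` is the relation `f ≥* g`: only finitely many `n` have `f n < g n`. -/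
def Dominates (f g : ℕ → ℕ) : Prop :=
  {n : ℕ | f n < g n}.Finite

/-- Every function `ℕ → ℕ` is dominated by some member of `F`. -/
def IsDominatingFamily (F : Set (ℕ → ℕ)) : Prop :=
  ∀ g : ℕ → ℕ, ∃ f ∈ F, Dominates f g

/-- A single function dominates all members of `F`. -/
def IsBoundedFamily (F : Set (ℕ → ℕ)) : Prop :=
  ∃ g : ℕ → ℕ, ∀ f ∈ F, Dominates g f

/-- The dominating number `𝔡`: the least cardinality of a dominating family. -/
noncomputable def dominatingNumber : Cardinal.{0} :=
  sInf {κ : Cardinal.{0} | ∃ F : Set (ℕ → ℕ), IsDominatingFamily F ∧ Cardinal.mk F = κ}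

/-- The bounding number `𝔟`: the least cardinality of an unbounded family. -/
noncomputable def boundingNumber : Cardinal.{0} :=
  sInf {κ : Cardinal.{0} | ∃ F : Set (ℕ → ℕ), ¬ IsBoundedFamily F ∧ Cardinal.mk F = κ}

/-- `R` is a ray (a one-way infinite path) of `G`. -/
def IsRay {V : Type u} (G : SimpleGraph V) (R : ℕ → V) : Prop :=
  Function.Injective R ∧ ∀ n : ℕ, G.Adj (R n) (R (n + 1))

/-- A graph is dominating if it has a labelling of its vertices for which the label sequences
along its rays form a dominating family. -/
def IsDominating {V : Type u} (G : SimpleGraph V) : Prop :=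
  ∃ L : V → ℕ, IsDominatingFamily {f : ℕ → ℕ | ∃ R : ℕ → V, IsRay G R ∧ f = L ∘ R}

/-- The degree of a vertex, as a cardinal. -/
noncomputable def cardDegree {W : Type u} (T : SimpleGraph W) (v : W) : Cardinal.{u} :=
  Cardinal.mk (T.neighborSet v)

/-- `T` is a subdivision of `T_ω`: a tree in which every vertex has degree 2 or countably
infinite degree, and in which every ray contains a vertex of infinite degree. -/
structure IsSubdivision {W : Type u} (T : SimpleGraph W) : Prop where
  isTree : T.IsTree
  degree : ∀ v : W, cardDegree T v = 2 ∨ cardDegree T v = Cardinal.aleph0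
  ray : ∀ R : ℕ → W, IsRay T R → ∃ n : ℕ, cardDegree T (R n) = Cardinal.aleph0

/-- The branch vertices of a subdivision `T` of `T_ω` are its vertices of infinite degree. -/
def IsBranch {W : Type u} (T : SimpleGraph W) (v : W) : Prop :=
  cardDegree T v = Cardinal.aleph0

/-- `p` is a subdivided edge at `x`: a path joining `x` to another branch vertex `y` that
contains no branch vertices besides its two ends. -/
def IsSubdividedEdge {W : Type u} (T : SimpleGraph W) {x y : W} (p : T.Walk x y) : Prop :=
  p.IsPath ∧ x ≠ y ∧ IsBranch T x ∧ IsBranch T y ∧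
    ∀ z ∈ p.support, IsBranch T z → z = x ∨ z = y

/-- `T` is a uniform subdivision of `T_ω`: it has a branch vertex `r` such that, for each branch
vertex `x`, all subdivided edges at `x` not contained in the path from `x` to `r` have
the same length. -/
def IsUniformSubdivision {W : Type u} (T : SimpleGraph W) : Prop :=
  IsSubdivision T ∧ ∃ r : W, IsBranch T r ∧
    ∀ x : W, IsBranch T x → ∀ q : T.Walk x r, q.IsPath →
      ∀ (y y' : W) (p : T.Walk x y) (p' : T.Walk x y'),
        IsSubdividedEdge T p → IsSubdividedEdge T p' →
        ¬ p.edges ⊆ q.edges → ¬ p'.edges ⊆ q.edges → p.length = p'.length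

/-- `G` contains a uniform subdivision of `T_ω` as a subgraph. -/
def ContainsUniformSubdivision {V : Type u} (G : SimpleGraph V) : Prop :=
  ∃ H : G.Subgraph, IsUniformSubdivision H.coe

/-- `G` contains `κ` pairwise (vertex-)disjoint subdivisions of `T_ω` as subgraphs. -/
def ContainsDisjointSubdivisions {V : Type u} (G : SimpleGraph V) (κ : Cardinal.{0}) : Prop :=
  ∃ (ι : Type) (H : ι → G.Subgraph), Cardinal.mk ι = κ ∧ (∀ i, IsSubdivision (H i).coe) ∧
    Pairwise fun i j => Disjoint (H i).verts (H j).verts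

/-- `G` contains `κ` pairwise (vertex-)disjoint rays. -/
def ContainsDisjointRays {V : Type u} (G : SimpleGraph V) (κ : Cardinal.{0}) : Prop :=
  ∃ (ι : Type) (R : ι → ℕ → V), Cardinal.mk ι = κ ∧ (∀ i, IsRay G (R i)) ∧
    Pairwise fun i j => Disjoint (Set.range (R i)) (Set.range (R j))

end DominatingGraphs

/-! Sufficiency. Label a subdivision so that labels are constant along each subdivided edge below
its top vertex. For monotone `f`, a descending ray beats `f` if at each branch vertex it can leave
along an edge whose label is at least `f` at the depth of the edge's lower end. In a uniform
subdivision these depths agree at each branch vertex, so unbounded labels suffice. An arbitrary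
subdivision can be labelled to serve all monotone `f` that fail to dominate one prescribed function
(`exists_ray_of_not_dominated`); hence `𝔟` disjoint ones, indexed by an unbounded family, serve
every `f`. On `𝔡` disjoint rays, copy a dominating family.

Necessity. If (2) and (3) fail, maximal disjoint families give a set `U` of fewer than `𝔟` vertices
meeting all countable subdivisions and a set `D` of fewer than `𝔡` vertices meeting all rays
(`exists_disjoint_or_transversal`). Outside `U` there is a rank function (`exists_rank`), by which
each vertex far enough along a ray determines a bound on labels that occur arbitrarily late. Since
`D` is small, some `h` is dominated by no ray outside `U` (`exists_undominated_of_no_subdivision`).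

So rays dominating `f + h`, with `h` made monotone, meet `U` infinitely often. As `U` is small, some
vertex starts walks that beat every function from one fixed position on and avoid any finite set
after the start (`exists_isFanGood`). Each such vertex is joined to others of its kind by paths of
one fixed length avoiding any finite set (`exists_fanWalk_length`, `exists_fanPath_length`), and
these paths assemble into a uniform subdivision. -/

namespace DominatingGraphs

universe u

/-! ### Rooted trees and rooted subdivisions -/

section

/-- `T` is a tree with root `r`, parent function `par` and depth function `dep`. -/
structure IsRooted {W : Type u} (T : SimpleGraph W) (r : W) (par : W → W) (dep : W → ℕ) :
    Prop where
  dep_root : dep r = 0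
  dep_par : ∀ v, v ≠ r → dep v = dep (par v) + 1
  adj_iff : ∀ u v, T.Adj u v ↔ (v ≠ r ∧ u = par v) ∨ (u ≠ r ∧ v = par u)

/-- The set of children of a vertex of a rooted tree. -/
def children {W : Type u} (r : W) (par : W → W) (v : W) : Set W := {c | c ≠ r ∧ par c = v}

/-- A rooted subdivision of `T_ω`, with `μ v` the distance from `v` down to the next
branch vertex. -/
structure IsRootedSubdivision {W : Type u} (T : SimpleGraph W) (r : W) (par : W → W)
    (dep μ : W → ℕ) : Prop extends IsRooted T r par dep where
  root : μ r = 0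
  step : ∀ v c, c ∈ children r par v → μ v ≠ 0 → μ c + 1 = μ v
  unique : ∀ v, μ v ≠ 0 → ∃! c, c ∈ children r par v
  infinite : ∀ v, μ v = 0 → (children r par v).Infinite
  countable : ∀ v, μ v = 0 → (children r par v).Countable

variable {W : Type u} {T : SimpleGraph W} {r : W} {par : W → W} {dep μ : W → ℕ}

namespace IsRooted

theorem adj_child (h : IsRooted T r par dep) {v c : W} (hc : c ∈ children r par v) :
    T.Adj v c := (h.adj_iff v c).2 (Or.inl ⟨hc.1, hc.2.symm⟩)

theorem adj_cases (h : IsRooted T r par dep) {v w : W} (hw : T.Adj v w) :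
    w ∈ children r par v ∨ (v ≠ r ∧ w = par v) := by
  rcases (h.adj_iff v w).1 hw with h1 | h1
  · exact Or.inl ⟨h1.1, h1.2.symm⟩
  · exact Or.inr h1

theorem adj_par (h : IsRooted T r par dep) {v : W} (hv : v ≠ r) : T.Adj v (par v) :=
  (h.adj_iff _ _).2 (Or.inr ⟨hv, rfl⟩)

theorem dep_child (h : IsRooted T r par dep) {v c : W} (hc : c ∈ children r par v) :
    dep c = dep v + 1 := by rw [h.dep_par c hc.1, hc.2]

theorem reachable_root (h : IsRooted T r par dep) (v : W) : T.Reachable v r := by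
  induction hn : dep v generalizing v with
  | zero =>
    by_cases hv : v = r
    · subst hv; rfl
    · have := h.dep_par v hv; omega
  | succ n ih =>
    by_cases hv : v = r
    · subst hv; rfl
    · have := h.dep_par v hv
      exact (h.adj_par hv).reachable.trans (ih _ (by omega))

/-- At a deepest vertex of a cycle, both cycle neighbours would have to be its parent. -/
theorem isTree (h : IsRooted T r par dep) : T.IsTree := by
  classical
  have hne : Nonempty W := ⟨r⟩
  refine ⟨⟨fun u v => (h.reachable_root u).trans (h.reachable_root v).symm⟩, ?_⟩
  intro v p hp
  obtain ⟨u, hu, hmax⟩ := Finset.exists_max_image p.support.toFinset dep ⟨v, by simp⟩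
  rw [List.mem_toFinset] at hu
  have hc : (p.rotate u hu).IsCycle := (SimpleGraph.Walk.isCycle_rotate hu).2 hp
  have key : ∀ w ∈ (p.rotate u hu).support, T.Adj u w → w = par u := by
    intro w hw hadj
    rw [SimpleGraph.Walk.mem_support_rotate_iff] at hw
    have h1 := hmax w (List.mem_toFinset.2 hw)
    rcases h.adj_cases hadj with h2 | h2
    · have := h.dep_child h2; omega
    · exact h2.2
  apply hc.snd_ne_penultimate
  exact (key _ (SimpleGraph.Walk.getVert_mem_support _ _)
    (SimpleGraph.Walk.adj_snd hc.not_nil)).trans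
    (key _ (SimpleGraph.Walk.getVert_mem_support _ _)
      (SimpleGraph.Walk.adj_penultimate hc.not_nil).symm).symm

/-- A path that has left `par c` for `c` only goes down. -/
theorem dep_le_of_descending (h : IsRooted T r par dep) {c y : W} (p : T.Walk c y)
    (hp : p.IsPath) (hc : par c ∉ p.support) : ∀ z ∈ p.support, dep c ≤ dep z := by
  induction p with
  | nil => simp
  | @cons a b d hab p ih =>
    rw [SimpleGraph.Walk.cons_isPath_iff] at hp
    rcases h.adj_cases hab with h1 | h1
    · intro z hz
      rw [SimpleGraph.Walk.support_cons, List.mem_cons] at hz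
      rcases hz with rfl | hz
      · exact le_rfl
      · have := ih hp.1 (by rw [h1.2]; exact hp.2) z hz
        have := h.dep_child h1
        omega
    · obtain ⟨-, rfl⟩ := h1
      exact absurd (by simp) hc

theorem snd_eq_par (h : IsRooted T r par dep) {v : W} (q : T.Walk v r) (hq : q.IsPath)
    (hv : v ≠ r) : ∃ (hadj : T.Adj v (par v)) (q' : T.Walk (par v) r),
      q'.IsPath ∧ q = SimpleGraph.Walk.cons hadj q' := by
  cases q with
  | nil => exact absurd rfl hv
  | @cons _ b _ hab q =>
    rw [SimpleGraph.Walk.cons_isPath_iff] at hq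
    rcases h.adj_cases hab with h1 | h1
    · have := h.dep_le_of_descending q hq.1 (by rw [h1.2]; exact hq.2) r (by simp)
      have := h.dep_child h1
      have := h.dep_root
      omega
    · obtain ⟨-, rfl⟩ := h1
      exact ⟨hab, q, hq.1, rfl⟩

theorem dep_le_of_mem_path_to_root (h : IsRooted T r par dep) {v : W} (q : T.Walk v r)
    (hq : q.IsPath) : ∀ z ∈ q.support, dep z ≤ dep v := by
  induction hn : dep v generalizing v with
  | zero =>
    have hv : v = r := by
      by_contra hv
      have := h.dep_par v hv; omega
    subst hv
    rw [SimpleGraph.Walk.isPath_iff_nil, SimpleGraph.Walk.nil_iff_support_eq] at hq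
    simp [hq, h.dep_root]
  | succ n ih =>
    have hv : v ≠ r := by
      rintro rfl
      have := h.dep_root; omega
    obtain ⟨hadj, q', hq', rfl⟩ := h.snd_eq_par q hq hv
    intro z hz
    rw [SimpleGraph.Walk.support_cons, List.mem_cons] at hz
    have := h.dep_par v hv
    rcases hz with rfl | hz
    · omega
    · have := ih q' hq' (by omega) z hz
      omega

end IsRooted

namespace IsRootedSubdivision

theorem neighborSet_root (h : IsRootedSubdivision T r par dep μ) :
    T.neighborSet r = children r par r := by
  ext w
  constructor
  · intro hw
    rcases h.adj_cases hw with h1 | h1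
    · exact h1
    · exact absurd rfl h1.1
  · exact fun hw => h.adj_child hw

theorem neighborSet_eq (h : IsRootedSubdivision T r par dep μ) {v : W} (hv : v ≠ r) :
    T.neighborSet v = insert (par v) (children r par v) := by
  ext w
  rw [Set.mem_insert_iff]
  constructor
  · intro hw
    rcases h.adj_cases hw with h1 | h1
    · exact Or.inr h1
    · exact Or.inl h1.2
  · rintro (rfl | hw)
    · exact h.adj_par hv
    · exact h.adj_child hw

theorem par_notMem_children (h : IsRootedSubdivision T r par dep μ) {v : W} (hv : v ≠ r) :
    par v ∉ children r par v := by
  intro hc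
  have := h.dep_child hc
  have := h.dep_par v hv
  omega

theorem cardDegree_of_eq_zero (h : IsRootedSubdivision T r par dep μ) {v : W} (hv : μ v = 0) :
    cardDegree T v = Cardinal.aleph0 := by
  have hi : (T.neighborSet v).Infinite :=
    (h.infinite v hv).mono fun c hc => h.adj_child hc
  have hc : (T.neighborSet v).Countable := by
    by_cases hvr : v = r
    · subst hvr
      rw [h.neighborSet_root]
      exact h.countable _ hv
    · rw [h.neighborSet_eq hvr]
      exact (h.countable v hv).insert _
  have := hi.to_subtype
  have := hc.to_subtype
  exact Cardinal.mk_eq_aleph0 _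

theorem cardDegree_of_ne_zero (h : IsRootedSubdivision T r par dep μ) {v : W} (hv : μ v ≠ 0) :
    cardDegree T v = 2 := by
  have hvr : v ≠ r := by
    rintro rfl
    exact hv h.root
  obtain ⟨c, hc, huniq⟩ := h.unique v hv
  have hch : children r par v = {c} := by
    ext w
    exact ⟨fun hw => huniq w hw, fun hw => by rw [Set.mem_singleton_iff.1 hw]; exact hc⟩
  have hne : par v ∉ ({c} : Set W) := hch ▸ h.par_notMem_children hvr
  unfold cardDegree
  rw [h.neighborSet_eq hvr, hch, Cardinal.mk_insert hne, Cardinal.mk_singleton]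
  norm_num

theorem isBranch_iff (h : IsRootedSubdivision T r par dep μ) (v : W) :
    IsBranch T v ↔ μ v = 0 := by
  constructor
  · intro hb
    by_contra hv
    have h1 := h.cardDegree_of_ne_zero hv
    rw [IsBranch, h1] at hb
    exact absurd hb (Cardinal.natCast_lt_aleph0 (n := 2)).ne
  · exact h.cardDegree_of_eq_zero

theorem isSubdivision (h : IsRootedSubdivision T r par dep μ) : IsSubdivision T := by
  refine ⟨h.toIsRooted.isTree, fun v => ?_, fun R hR => ?_⟩
  · by_cases hv : μ v = 0
    · exact Or.inr (h.cardDegree_of_eq_zero hv)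
    · exact Or.inl (h.cardDegree_of_ne_zero hv)
  · by_contra! hcon
    have hμ : ∀ n, μ (R n) ≠ 0 := fun n hn => hcon n (h.cardDegree_of_eq_zero hn)
    -- Depth cannot drop forever, so the ray steps down once. By injectivity it never turns back up,
    -- and then `μ` would decrease forever.
    have hdown : ∃ n, R (n + 1) ∈ children r par (R n) := by
      by_contra! hup
      have hd : ∀ n, dep (R n) = dep (R (n + 1)) + 1 := by
        intro n
        rcases h.adj_cases (hR.2 n) with h1 | h1
        · exact absurd h1 (hup n)
        · rw [h1.2]; exact h.dep_par _ h1.1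
      have : ∀ n, dep (R n) + n = dep (R 0) := by
        intro n
        induction n with
        | zero => rfl
        | succ n ih => have := hd n; omega
      have := this (dep (R 0) + 1)
      omega
    obtain ⟨n, hn⟩ := hdown
    have hall : ∀ k, R (n + k + 1) ∈ children r par (R (n + k)) := by
      intro k
      induction k with
      | zero => exact hn
      | succ k ih =>
        rcases h.adj_cases (hR.2 (n + (k + 1))) with h1 | h1
        · exact h1
        · have h2 := h1.2
          rw [show n + (k + 1) = n + k + 1 from rfl, ih.2] at h2
          have := hR.1 h2
          omega
    have : ∀ k, μ (R (n + k)) + k = μ (R n) := by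
      intro k
      induction k with
      | zero => rfl
      | succ k ih =>
        have := h.step _ _ (hall k) (hμ _)
        have h3 : n + (k + 1) = n + k + 1 := rfl
        rw [h3]
        omega
    have := this (μ (R n) + 1)
    omega

/-- From every vertex there is a path straight down to the next branch vertex. -/
theorem exists_descending_path (h : IsRootedSubdivision T r par dep μ) (v : W) :
    ∃ (y : W) (p : T.Walk v y), p.IsPath ∧ p.length = μ v ∧ μ y = 0 ∧
      ∀ z ∈ p.support, dep v ≤ dep z ∧ (μ z = 0 → z = y) := by
  induction hn : μ v generalizing v with
  | zero => exact ⟨v, .nil, by simp, by simp, hn, by simp⟩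
  | succ n ih =>
    obtain ⟨c, hc, -⟩ := h.unique v (by omega)
    have h1 := h.step v c hc (by omega)
    obtain ⟨y, p, hp, hl, hy, hz⟩ := ih c (by omega)
    have hdc := h.dep_child hc
    refine ⟨y, .cons (h.adj_child hc) p, ?_, by simp [hl], hy, ?_⟩
    · rw [SimpleGraph.Walk.cons_isPath_iff]
      refine ⟨hp, fun hv => ?_⟩
      have := (hz v hv).1
      omega
    · intro z hz'
      rw [SimpleGraph.Walk.support_cons, List.mem_cons] at hz'
      rcases hz' with rfl | hz'
      · exact ⟨le_rfl, fun h0 => by omega⟩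
      · exact ⟨by have := (hz z hz').1; omega, (hz z hz').2⟩

theorem length_eq_of_descending (h : IsRootedSubdivision T r par dep μ) {c y : W}
    (p : T.Walk c y) (hp : p.IsPath) (hc : par c ∉ p.support) (hy : μ y = 0)
    (hz : ∀ z ∈ p.support, μ z = 0 → z = y) : p.length = μ c := by
  induction p with
  | nil => simp [hy]
  | @cons a b d hab p ih =>
    rw [SimpleGraph.Walk.cons_isPath_iff] at hp
    rcases h.adj_cases hab with h1 | h1
    · have ha : μ a ≠ 0 := by
        intro h0
        have h2 : a = d := hz a (by simp) h0
        exact hp.2 (h2 ▸ SimpleGraph.Walk.end_mem_support p)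
      rw [SimpleGraph.Walk.length_cons, ih hp.1 (by rw [h1.2]; exact hp.2) hy
        fun z hzp => hz z (by simp [hzp])]
      exact h.step _ _ h1 ha
    · obtain ⟨-, rfl⟩ := h1
      exact absurd (by simp) hc

/-- Before `y` the path passes no branch vertex after `v`, and the only child of such a vertex is
the one it came from. So it cannot turn downwards. -/
theorem edges_subset_of_ascending (h : IsRootedSubdivision T r par dep μ) {v y : W}
    (hadj : T.Adj v (par v)) (hv : v ≠ r) (p : T.Walk (par v) y)
    (hp : (SimpleGraph.Walk.cons hadj p).IsPath) (hz : ∀ z ∈ p.support, μ z = 0 → z = y)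
    (q : T.Walk v r) (hq : q.IsPath) : (SimpleGraph.Walk.cons hadj p).edges ⊆ q.edges := by
  induction hn : dep v generalizing v with
  | zero => have := h.dep_par v hv; omega
  | succ n ih =>
    obtain ⟨hadj', q', hq', rfl⟩ := h.snd_eq_par q hq hv
    rw [SimpleGraph.Walk.edges_cons, SimpleGraph.Walk.edges_cons]
    apply List.cons_subset_cons
    cases p with
    | nil => simp
    | @cons _ b _ hab p =>
      rw [SimpleGraph.Walk.cons_isPath_iff] at hp
      have hp2 := hp.1
      rw [SimpleGraph.Walk.cons_isPath_iff] at hp2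
      have hμ : μ (par v) ≠ 0 := by
        intro h0
        have h2 := hz _ (by simp) h0
        exact hp2.2 (h2 ▸ SimpleGraph.Walk.end_mem_support p)
      have hpr : par v ≠ r := by
        intro h0
        rw [h0] at hμ
        exact hμ h.root
      rcases h.adj_cases hab with h1 | h1
      · have : b = v := (h.unique _ hμ).unique h1 ⟨hv, rfl⟩
        subst this
        exact absurd (by simp) hp.2
      · obtain ⟨-, rfl⟩ := h1
        have := h.dep_par v hv
        exact ih hab hpr p hp.1 (fun z hzp => hz z (by simp [hzp])) q' hq' (by omega)

/-- Subdivided edges leaving `x` upwards lie on the path to the root, so only the downward ones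
matter; through a child `c` these have length `μ c + 1`. -/
theorem isUniformSubdivision (h : IsRootedSubdivision T r par dep μ) (ℓ : W → ℕ)
    (hℓ : ∀ x c, μ x = 0 → c ∈ children r par x → μ c + 1 = ℓ x) :
    IsUniformSubdivision T := by
  refine ⟨h.isSubdivision, r, (h.isBranch_iff r).2 h.root, ?_⟩
  intro x hx q hq
  have hx0 := (h.isBranch_iff x).1 hx
  have key : ∀ (y : W) (p : T.Walk x y), IsSubdividedEdge T p → ¬ p.edges ⊆ q.edges →
      p.length = ℓ x := by
    intro y p hp hpq
    obtain ⟨hpath, hne, -, hy, hz⟩ := hp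
    cases p with
    | nil => exact absurd rfl hne
    | @cons _ b _ hab p =>
      have hpath' := hpath
      rw [SimpleGraph.Walk.cons_isPath_iff] at hpath'
      have hz' : ∀ z ∈ p.support, μ z = 0 → z = y := by
        intro z hzp hz0
        rcases hz z (by simp [hzp]) ((h.isBranch_iff z).2 hz0) with rfl | h1
        · exact absurd hzp hpath'.2
        · exact h1
      rcases h.adj_cases hab with h1 | h1
      · rw [SimpleGraph.Walk.length_cons, h.length_eq_of_descending p hpath'.1
          (by rw [h1.2]; exact hpath'.2) ((h.isBranch_iff y).1 hy) hz']
        exact hℓ x b hx0 h1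
      · obtain ⟨hxr, rfl⟩ := h1
        exact absurd (h.edges_subset_of_ascending hab hxr p hpath hz' q hq) hpq
  intro y y' p p' hp hp' hpq hpq'
  rw [key y p hp hpq, key y' p' hp' hpq']

theorem eq_of_isUniform (h : IsRootedSubdivision T r par dep μ)
    (hr : ∀ x : W, IsBranch T x → ∀ q : T.Walk x r, q.IsPath →
      ∀ (y y' : W) (p : T.Walk x y) (p' : T.Walk x y'),
        IsSubdividedEdge T p → IsSubdividedEdge T p' →
        ¬ p.edges ⊆ q.edges → ¬ p'.edges ⊆ q.edges → p.length = p'.length)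
    {x c c' : W} (hx : μ x = 0) (hc : c ∈ children r par x) (hc' : c' ∈ children r par x) :
    μ c = μ c' := by
  obtain ⟨q, hq⟩ := (h.reachable_root x).exists_isPath
  have key : ∀ c ∈ children r par x, ∃ (y : W) (p : T.Walk x y), IsSubdividedEdge T p ∧
      ¬ p.edges ⊆ q.edges ∧ p.length = μ c + 1 := by
    intro c hc
    obtain ⟨y, p, hp, hl, hy, hz⟩ := h.exists_descending_path c
    have hdc := h.dep_child hc
    have hxp : x ∉ p.support := fun hxp => by
      have := (hz x hxp).1
      omega
    refine ⟨y, .cons (h.adj_child hc) p, ⟨?_, ?_, ?_, ?_, ?_⟩, ?_, by simp [hl]⟩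
    · exact (SimpleGraph.Walk.cons_isPath_iff _ _).2 ⟨hp, hxp⟩
    · rintro rfl
      exact hxp (SimpleGraph.Walk.end_mem_support p)
    · exact (h.isBranch_iff x).2 hx
    · exact (h.isBranch_iff y).2 hy
    · intro z hz' hzb
      rw [SimpleGraph.Walk.support_cons, List.mem_cons] at hz'
      rcases hz' with rfl | hz'
      · exact Or.inl rfl
      · exact Or.inr ((hz z hz').2 ((h.isBranch_iff z).1 hzb))
    · intro hsub
      have h1 : s(x, c) ∈ q.edges := hsub (by simp)
      have := h.dep_le_of_mem_path_to_root q hq c (q.snd_mem_support_of_mem_edges h1)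
      omega
  obtain ⟨y, p, hp, hpq, hpl⟩ := key c hc
  obtain ⟨y', p', hp', hpq', hpl'⟩ := key c' hc'
  have := hr x ((h.isBranch_iff x).2 hx) q hq y y' p p' hp hp' hpq hpq'
  omega

end IsRootedSubdivision

end

/-! ### Rooting an arbitrary subdivision -/

section

variable {W : Type u} {T : SimpleGraph W}

theorem exists_isRooted (hT : T.IsTree) (r : W) :
    ∃ par : W → W, IsRooted T r par (T.dist r) := by
  classical
  have hconn := hT.connected
  have hex : ∀ v, v ≠ r → ∃ w, T.Adj v w ∧ T.dist r v = T.dist r w + 1 := by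
    intro v hv
    obtain ⟨p, hp⟩ := hconn.exists_walk_length_eq_dist v r
    cases p with
    | nil => exact absurd rfl hv
    | @cons _ w _ hadj p =>
      refine ⟨w, hadj, ?_⟩
      have h1 := SimpleGraph.dist_le p
      rw [SimpleGraph.Walk.length_cons, SimpleGraph.dist_comm] at hp
      rw [SimpleGraph.dist_comm] at h1
      rcases hT.dist_eq_dist_add_one_of_adj r hadj with h2 | h2 <;> omega
  have huniq : ∀ v w w', T.Adj v w → T.Adj v w' → T.dist r v = T.dist r w + 1 →
      T.dist r v = T.dist r w' + 1 → w = w' := by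
    intro v w w' h h' hd hd'
    have key : ∀ w, T.Adj v w → T.dist r v = T.dist r w + 1 →
        ∃ p : T.Walk v r, p.IsPath ∧ p.snd = w := by
      intro w h hd
      obtain ⟨p, hp⟩ := hconn.exists_walk_length_eq_dist w r
      refine ⟨.cons h p, SimpleGraph.Walk.isPath_of_length_eq_dist _ ?_, by simp⟩
      rw [SimpleGraph.Walk.length_cons, hp, SimpleGraph.dist_comm, ← hd, SimpleGraph.dist_comm]
    obtain ⟨p, hp, rfl⟩ := key w h hd
    obtain ⟨p', hp', rfl⟩ := key w' h' hd'
    have : p = p' := (hT.existsUnique_path v r).unique hp hp'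
    rw [this]
  choose! par hpar using hex
  refine ⟨par, SimpleGraph.dist_self, fun v hv => (hpar v hv).2, fun u v => ⟨fun h => ?_, ?_⟩⟩
  · rcases hT.dist_eq_dist_add_one_of_adj r h with h1 | h1
    · have hu : u ≠ r := by
        rintro rfl
        rw [SimpleGraph.dist_self] at h1
        omega
      exact Or.inr ⟨hu, huniq u _ _ h (hpar u hu).1 h1 (hpar u hu).2⟩
    · have hv : v ≠ r := by
        rintro rfl
        rw [SimpleGraph.dist_self] at h1
        omega
      exact Or.inl ⟨hv, huniq v _ _ h.symm (hpar v hv).1 h1 (hpar v hv).2⟩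
  · rintro (⟨hv, rfl⟩ | ⟨hu, rfl⟩)
    · exact (hpar v hv).1.symm
    · exact (hpar u hu).1

theorem IsRooted.neighborSet_subset {r : W} {par : W → W} {dep : W → ℕ}
    (h : IsRooted T r par dep) (v : W) : T.neighborSet v ⊆ insert (par v) (children r par v) := by
  intro w hw
  rcases h.adj_cases hw with h1 | h1
  · exact Or.inr h1
  · exact Or.inl h1.2

theorem IsRooted.eq_of_degree_two {r : W} {par : W → W} {dep : W → ℕ}
    (h : IsRooted T r par dep) {v : W} (hv : cardDegree T v = 2) (hvr : v ≠ r) :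
    ∃! c, c ∈ children r par v := by
  obtain ⟨x, y, hxy, huniv⟩ := Cardinal.mk_eq_two_iff.1 hv
  have hall : ∀ w : T.neighborSet v, w = x ∨ w = y := fun w => by
    have : w ∈ ({x, y} : Set (T.neighborSet v)) := by rw [huniv]; trivial
    simpa using this
  have hpar : par v ∉ children r par v := by
    intro hc
    have := h.dep_child hc
    have := h.dep_par v hvr
    omega
  have key : ∀ x y : T.neighborSet v, x ≠ y → (∀ w : T.neighborSet v, w = x ∨ w = y) →
      par v = x.1 → ∃! c, c ∈ children r par v := by
    intro x y hxy hall hx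
    refine ⟨y.1, ?_, fun c hc => ?_⟩
    · rcases h.adj_cases y.2 with h1 | h1
      · exact h1
      · exact absurd (Subtype.ext (hx.symm.trans h1.2.symm)) hxy
    · rcases hall ⟨c, h.adj_child hc⟩ with h1 | h1
      · have h2 : c = par v := by rw [hx]; exact congrArg Subtype.val h1
        exact absurd (h2 ▸ hc) hpar
      · exact congrArg Subtype.val h1
  rcases hall ⟨par v, h.adj_par hvr⟩ with h1 | h1
  · exact key x y hxy hall (congrArg Subtype.val h1)
  · exact key y x hxy.symm (fun w => (hall w).symm) (congrArg Subtype.val h1)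

/-- Iterating a choice of children gives a ray, which must hit a branch vertex; `μ` counts the steps
needed. The choice is forced at non-branch vertices, so it does not affect `μ`. -/
theorem exists_isRootedSubdivision (hT : IsSubdivision T) {r : W} (hr : IsBranch T r) :
    ∃ (par : W → W) (dep μ : W → ℕ), IsRootedSubdivision T r par dep μ := by
  classical
  obtain ⟨par, h⟩ := exists_isRooted hT.isTree r
  have hinf : ∀ v, IsBranch T v → (children r par v).Infinite := by
    intro v hv hfin
    have hcard : Cardinal.mk (T.neighborSet v) = Cardinal.aleph0 := hv
    have : (T.neighborSet v).Infinite := by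
      rw [← Set.infinite_coe_iff, Cardinal.infinite_iff, hcard]
    exact this ((hfin.insert (par v)).subset (h.neighborSet_subset v))
  have hone : ∀ v, ¬ IsBranch T v → ∃! c, c ∈ children r par v := by
    intro v hv
    exact h.eq_of_degree_two ((hT.degree v).resolve_right hv)
      (by rintro rfl; exact hv hr)
  have hex : ∀ v, ∃ c, c ∈ children r par v := by
    intro v
    by_cases hv : IsBranch T v
    · exact (hinf v hv).nonempty
    · exact (hone v hv).exists
  choose ch hch using hex
  have hdep : ∀ v n, T.dist r (ch^[n] v) = T.dist r v + n := by
    intro v n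
    induction n with
    | zero => rfl
    | succ n ih =>
      rw [Function.iterate_succ_apply', h.dep_child (hch _), ih]
      rfl
  have hray : ∀ v, ∃ n, IsBranch T (ch^[n] v) := by
    intro v
    refine hT.ray (fun n => ch^[n] v) ⟨fun m n hmn => ?_, fun n => ?_⟩
    · have h1 := hdep v m
      have h2 := hdep v n
      have h3 : ch^[m] v = ch^[n] v := hmn
      rw [h3] at h1
      omega
    · have h1 := h.adj_child (hch (ch^[n] v))
      simpa only [Function.iterate_succ_apply'] using h1
  have hzero : ∀ v, Nat.find (hray v) = 0 ↔ IsBranch T v := fun v => by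
    rw [Nat.find_eq_zero]; rfl
  refine ⟨par, T.dist r, fun v => Nat.find (hray v), h, (hzero r).2 hr, ?_, ?_, ?_, ?_⟩
  · intro v c hc hv
    have hvb := mt (hzero v).2 hv
    have hcv : c = ch v := (hone v hvb).unique hc (hch v)
    subst hcv
    symm
    have h0 : ¬ IsBranch T (ch^[0] v) := hvb
    rw [Nat.find_eq_iff]
    refine ⟨?_, ?_⟩
    · rw [Function.iterate_succ_apply]
      exact Nat.find_spec (hray (ch v))
    · intro n hn
      cases n with
      | zero => exact h0
      | succ n =>
        rw [Function.iterate_succ_apply]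
        exact Nat.find_min (hray (ch v)) (by omega)
  · exact fun v hv => hone v (mt (hzero v).2 hv)
  · exact fun v hv => hinf v ((hzero v).1 hv)
  · intro v hv
    have hcard : Cardinal.mk (T.neighborSet v) = Cardinal.aleph0 := (hzero v).1 hv
    have : (T.neighborSet v).Countable := by
      rw [← Set.countable_coe_iff, ← Cardinal.mk_le_aleph0_iff, hcard]
    exact this.mono fun c hc => h.adj_child hc

/-- Otherwise one could descend forever along a ray of vertices of degree 2. -/
theorem IsSubdivision.exists_isBranch (hT : IsSubdivision T) : ∃ r, IsBranch T r := by
  by_contra! hcon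
  obtain ⟨r⟩ := hT.isTree.connected.nonempty
  obtain ⟨par, h⟩ := exists_isRooted hT.isTree r
  have hdeg : ∀ v, cardDegree T v = 2 := fun v => (hT.degree v).resolve_right (hcon v)
  have hex : ∀ v, ∃ c, c ∈ children r par v := by
    intro v
    by_cases hv : v = r
    · subst hv
      obtain ⟨x, -⟩ := Cardinal.mk_eq_two_iff.1 (hdeg v)
      rcases h.adj_cases x.2 with h1 | h1
      · exact ⟨_, h1⟩
      · exact absurd rfl h1.1
    · exact (h.eq_of_degree_two (hdeg v) hv).exists
  choose ch hch using hex
  have hdep : ∀ v n, T.dist r (ch^[n] v) = T.dist r v + n := by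
    intro v n
    induction n with
    | zero => rfl
    | succ n ih =>
      rw [Function.iterate_succ_apply', h.dep_child (hch _), ih]
      rfl
  obtain ⟨n, hn⟩ := hT.ray (fun n => ch^[n] r) ⟨fun m n hmn => by
    have h1 := hdep r m
    have h2 := hdep r n
    have h3 : ch^[m] r = ch^[n] r := hmn
    rw [h3] at h1
    omega, fun n => by
    have h1 := h.adj_child (hch (ch^[n] r))
    simpa only [Function.iterate_succ_apply'] using h1⟩
  exact hcon _ hn

end

/-! ### Labelling a rooted subdivision -/

theorem IsRootedSubdivision.exists_label {W : Type u} {T : SimpleGraph W} {r : W} {par : W → W}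
    {dep μ : W → ℕ} (h : IsRootedSubdivision T r par dep μ) (g : W → ℕ) :
    ∃ L : W → ℕ, ∀ v c, c ∈ children r par v → L c = if μ v = 0 then g c else L v := by
  classical
  -- Recursion on depth: a label is set just below a branch vertex and inherited down to the next
  -- one, inclusive. The root gets a dummy label.
  let A : ℕ → W → ℕ := fun n => Nat.rec (fun _ => 0)
    (fun _ B v => if μ (par v) = 0 then g v else B (par v)) n
  refine ⟨fun v => A (dep v) v, fun v c hc => ?_⟩
  show A (dep c) c = _
  rw [h.dep_child hc]
  show (if μ (par c) = 0 then g c else A (dep v) (par c)) = _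
  rw [hc.2]

/-- `dep c + μ c` is the depth of the lower end of the subdivided edge through `c`; by monotonicity,
beating `f` there beats it along the whole edge. The root's label is uncontrolled, whence the shift
by one. -/
theorem IsRootedSubdivision.exists_ray {W : Type u} {T : SimpleGraph W} {r : W} {par : W → W}
    {dep μ : W → ℕ} (h : IsRootedSubdivision T r par dep μ) {g L : W → ℕ}
    (hL : ∀ v c, c ∈ children r par v → L c = if μ v = 0 then g c else L v)
    {f : ℕ → ℕ} (hf : Monotone f)
    (hg : ∀ x, μ x = 0 → ∃ c ∈ children r par x, f (dep c + μ c) ≤ g c) :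
    ∃ R : ℕ → W, IsRay T R ∧ ∀ n, f (n + 1) ≤ L (R (n + 1)) := by
  have hex : ∀ v, ∃ c, c ∈ children r par v ∧ (μ v = 0 → f (dep c + μ c) ≤ g c) := by
    intro v
    by_cases hv : μ v = 0
    · obtain ⟨c, hc, h1⟩ := hg v hv
      exact ⟨c, hc, fun _ => h1⟩
    · obtain ⟨c, hc, -⟩ := h.unique v hv
      exact ⟨c, hc, fun h0 => absurd h0 hv⟩
  choose ch hch hfch using hex
  have hsucc : ∀ n, ch^[n + 1] r = ch (ch^[n] r) := fun n => Function.iterate_succ_apply' _ _ _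
  have hdep : ∀ n, dep (ch^[n] r) = n := by
    intro n
    induction n with
    | zero => exact h.dep_root
    | succ n ih => rw [hsucc, h.dep_child (hch _), ih]
  refine ⟨fun n => ch^[n] r, ⟨fun m n hmn => ?_, fun n => ?_⟩, ?_⟩
  · rw [← hdep m, ← hdep n]
    exact congrArg dep hmn
  · have := h.adj_child (hch (ch^[n] r))
    rwa [← hsucc] at this
  · have key : ∀ n, f (n + 1 + μ (ch^[n + 1] r)) ≤ L (ch^[n + 1] r) := by
      intro n
      induction n with
      | zero =>
        have h1 := hL _ _ (hch r)
        rw [if_pos h.root] at h1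
        have h2 := hfch r h.root
        rw [← h1] at h2
        have h3 := h.dep_child (hch r)
        rw [h.dep_root] at h3
        rw [h3] at h2
        exact h2
      | succ n ih =>
        have h1 := hL _ _ (hch (ch^[n + 1] r))
        have hd := hdep (n + 1 + 1)
        rw [hsucc (n + 1)] at hd ⊢
        by_cases h0 : μ (ch^[n + 1] r) = 0
        · rw [if_pos h0] at h1
          have h2 := hfch _ h0
          rw [hd, ← h1] at h2
          exact h2
        · rw [if_neg h0] at h1
          rw [h1]
          have h2 := h.step _ _ (hch (ch^[n + 1] r)) h0
          refine le_trans (hf ?_) ih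
          omega
    exact fun n => le_trans (hf (by omega)) (key n)

/-- A monotone majorant of `f`. -/
def majorant (f : ℕ → ℕ) (n : ℕ) : ℕ := ∑ i ∈ Finset.range (n + 1), f i

theorem majorant_monotone (f : ℕ → ℕ) : Monotone (majorant f) := fun _ _ hmn =>
  Finset.sum_le_sum_of_subset (Finset.range_mono (by omega))

theorem le_majorant (f : ℕ → ℕ) (n : ℕ) : f n ≤ majorant f n :=
  Finset.single_le_sum (f := f) (fun _ _ => Nat.zero_le _) (Finset.mem_range.2 (by omega))

theorem dominates_iff {f g : ℕ → ℕ} : Dominates f g ↔ ∃ N, ∀ n ≥ N, g n ≤ f n := by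
  unfold Dominates
  constructor
  · intro h
    obtain ⟨N, hN⟩ := h.bddAbove
    refine ⟨N + 1, fun n hn => ?_⟩
    by_contra hlt
    have := hN (show n ∈ {n | f n < g n} from not_le.1 hlt)
    omega
  · rintro ⟨N, hN⟩
    refine (Set.finite_lt_nat N).subset fun n hn => ?_
    by_contra hlt
    exact absurd (hN n (not_lt.1 hlt)) (not_le.2 hn)

theorem isDominatingFamily_of_monotone {F : Set (ℕ → ℕ)}
    (h : ∀ g, Monotone g → ∃ f ∈ F, Dominates f g) : IsDominatingFamily F := by
  intro g
  obtain ⟨f, hf, hd⟩ := h _ (majorant_monotone g)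
  rw [dominates_iff] at hd
  obtain ⟨N, hN⟩ := hd
  exact ⟨f, hf, dominates_iff.2 ⟨N, fun n hn => (le_majorant g n).trans (hN n hn)⟩⟩

/-- A graph is dominating if its eventually dominating rays can be found for monotone functions. -/
theorem isDominating_of_monotone {V : Type u} {G : SimpleGraph V} (L : V → ℕ)
    (h : ∀ f, Monotone f → ∃ R, IsRay G R ∧ ∃ N, ∀ n ≥ N, f n ≤ L (R n)) : IsDominating G := by
  refine ⟨L, isDominatingFamily_of_monotone fun f hf => ?_⟩
  obtain ⟨R, hR, hN⟩ := h f hf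
  exact ⟨L ∘ R, ⟨R, hR, rfl⟩, dominates_iff.2 hN⟩

theorem IsRay.of_subgraph {V : Type u} {G : SimpleGraph V} {H : G.Subgraph} {R : ℕ → H.verts}
    (hR : IsRay H.coe R) : IsRay G fun n => (R n : V) :=
  ⟨fun _ _ h => hR.1 (Subtype.ext h), fun n => H.adj_sub (hR.2 n)⟩

theorem exists_le_of_injOn {W : Type u} {s : Set W} (hs : s.Infinite) {k : W → ℕ}
    (hk : Set.InjOn k s) (n : ℕ) : ∃ c ∈ s, n ≤ k c := by
  by_contra! h
  exact (hs.image hk) ((Set.finite_lt_nat n).subset (by rintro _ ⟨c, hc, rfl⟩; exact h c hc))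

theorem IsRootedSubdivision.exists_enumeration {W : Type u} {T : SimpleGraph W} {r : W}
    {par : W → W} {dep μ : W → ℕ} (h : IsRootedSubdivision T r par dep μ) :
    ∃ k : W → ℕ, ∀ x, μ x = 0 → Set.InjOn k (children r par x) := by
  have : ∀ x, ∃ k : W → ℕ, μ x = 0 → Set.InjOn k (children r par x) := by
    intro x
    by_cases hx : μ x = 0
    · obtain ⟨k, hk⟩ := Set.countable_iff_exists_injOn.1 (h.countable x hx)
      exact ⟨k, fun _ => hk⟩
    · exact ⟨fun _ => 0, fun h0 => absurd h0 hx⟩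
  choose k hk using this
  refine ⟨fun c => k (par c) c, fun x hx c hc c' hc' hcc => ?_⟩
  simp only [hc.2, hc'.2] at hcc
  exact hk x hx hc hc' hcc

theorem IsRootedSubdivision.exists_ray_of_uniform {W : Type u} {T : SimpleGraph W} {r : W}
    {par : W → W} {dep μ : W → ℕ} (h : IsRootedSubdivision T r par dep μ)
    (hμ : ∀ x c c', μ x = 0 → c ∈ children r par x → c' ∈ children r par x → μ c = μ c') :
    ∃ L : W → ℕ, ∀ f, Monotone f → ∃ R, IsRay T R ∧ ∀ n, f (n + 1) ≤ L (R (n + 1)) := by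
  obtain ⟨k, hk⟩ := h.exists_enumeration
  obtain ⟨L, hL⟩ := h.exists_label k
  refine ⟨L, fun f hf => h.exists_ray hL hf fun x hx => ?_⟩
  obtain ⟨c₀, hc₀⟩ := (h.infinite x hx).nonempty
  obtain ⟨c, hc, hle⟩ := exists_le_of_injOn (h.infinite x hx) (hk x hx) (f (dep c₀ + μ c₀))
  refine ⟨c, hc, ?_⟩
  rwa [h.dep_child hc, hμ x c c₀ hx hc hc₀, ← h.dep_child hc₀]

theorem IsRootedSubdivision.exists_ray_of_not_dominated {W : Type u} {T : SimpleGraph W} {r : W}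
    {par : W → W} {dep μ : W → ℕ} (h : IsRootedSubdivision T r par dep μ) {G : ℕ → ℕ}
    (hG : Monotone G) :
    ∃ L : W → ℕ, ∀ f, Monotone f → ¬ Dominates f G →
      ∃ R, IsRay T R ∧ ∀ n, f (n + 1) ≤ L (R (n + 1)) := by
  obtain ⟨k, hk⟩ := h.exists_enumeration
  let D : W → ℕ := fun c => dep c + μ c
  -- `N c` is the next end depth after `D c` among the siblings of `c`.
  let N : W → ℕ := fun c => sInf {m | ∃ c' ∈ children r par (par c), D c < m ∧ m = D c'}
  obtain ⟨L, hL⟩ := h.exists_label fun c => max (k c) (G (N c))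
  refine ⟨L, fun f hf hfG => h.exists_ray hL hf fun x hx => ?_⟩
  by_cases hb : ∃ B, ∀ c ∈ children r par x, D c ≤ B
  · obtain ⟨B, hB⟩ := hb
    obtain ⟨c, hc, hle⟩ := exists_le_of_injOn (h.infinite x hx) (hk x hx) (f B)
    exact ⟨c, hc, ((hf (hB c hc)).trans hle).trans (le_max_left _ _)⟩
  · push Not at hb
    obtain ⟨c₀, hc₀⟩ := (h.infinite x hx).nonempty
    obtain ⟨n, hn, hfn⟩ : ∃ n ≥ D c₀, f n < G n := by
      by_contra! hcon
      exact hfG (dominates_iff.2 ⟨_, hcon⟩)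
    -- Taking the deepest end not below level `n` gives `D c ≤ n < N c`, hence `f (D c) ≤ f n < G n
    -- ≤ G (N c)`.
    let S : Set ℕ := {m | m ≤ n ∧ ∃ c ∈ children r par x, m = D c}
    have hSne : S.Nonempty := ⟨D c₀, hn, c₀, hc₀, rfl⟩
    have hSb : BddAbove S := ⟨n, fun m hm => hm.1⟩
    obtain ⟨hle, c, hc, hcD⟩ := Nat.sSup_mem hSne hSb
    refine ⟨c, hc, le_trans ?_ (le_max_right _ _)⟩
    have hne : {m | ∃ c' ∈ children r par (par c), D c < m ∧ m = D c'}.Nonempty := by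
      obtain ⟨c', hc', hlt⟩ := hb (D c)
      exact ⟨D c', c', by rwa [hc.2], hlt, rfl⟩
    obtain ⟨c', hc', hlt, hN⟩ := Nat.sInf_mem hne
    have hnN : n < N c := by
      by_contra hle'
      have hmem : N c ∈ S := ⟨not_lt.1 hle', c', by rwa [hc.2] at hc', hN⟩
      have h1 := le_csSup hSb hmem
      rw [hcD] at h1
      exact absurd hlt (not_lt.2 h1)
    calc f (dep c + μ c) ≤ f n := hf (by rw [← show D c = dep c + μ c from rfl, ← hcD]; exact hle)
      _ ≤ G n := hfn.le
      _ ≤ G (N c) := hG hnN.le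

/-! ### The cardinals `𝔟` and `𝔡` -/

theorem exists_boundingNumber : ∃ F : Set (ℕ → ℕ), ¬ IsBoundedFamily F ∧
    Cardinal.mk F = boundingNumber := by
  refine csInf_mem (s := {κ : Cardinal.{0} | ∃ F : Set (ℕ → ℕ), ¬ IsBoundedFamily F ∧
    Cardinal.mk F = κ}) ⟨_, Set.univ, ?_, rfl⟩
  rintro ⟨g, hg⟩
  obtain ⟨N, hN⟩ := dominates_iff.1 (hg (fun n => g n + 1) trivial)
  have := hN N le_rfl
  omega

theorem exists_dominatingNumber : ∃ F : Set (ℕ → ℕ), IsDominatingFamily F ∧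
    Cardinal.mk F = dominatingNumber := by
  refine csInf_mem (s := {κ : Cardinal.{0} | ∃ F : Set (ℕ → ℕ), IsDominatingFamily F ∧
    Cardinal.mk F = κ}) ⟨_, Set.univ, ?_, rfl⟩
  exact fun g => ⟨g, trivial, dominates_iff.2 ⟨0, fun _ _ => le_rfl⟩⟩

/-- A family indexed by fewer than `𝔟` points is bounded. -/
theorem exists_dominates_of_lt_boundingNumber {ι : Type u} {s : Set ι}
    (hs : Cardinal.mk s < Cardinal.lift.{u} boundingNumber) (f : ι → ℕ → ℕ) :
    ∃ g : ℕ → ℕ, ∀ i ∈ s, Dominates g (f i) := by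
  have hlt : Cardinal.mk (f '' s) < boundingNumber := by
    have := (Cardinal.mk_image_le_lift (f := f) (s := s)).trans_lt
      (by simpa using hs)
    simpa using this
  by_contra! hcon
  refine notMem_of_lt_csInf' hlt ⟨f '' s, ?_, rfl⟩
  rintro ⟨g, hg⟩
  obtain ⟨i, hi, h⟩ := hcon g
  exact h (hg _ ⟨i, hi, rfl⟩)

/-- A family indexed by fewer than `𝔡` points is not dominating. -/
theorem exists_not_dominates_of_lt_dominatingNumber {ι : Type u} {s : Set ι}
    (hs : Cardinal.mk s < Cardinal.lift.{u} dominatingNumber) (f : ι → ℕ → ℕ) :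
    ∃ g : ℕ → ℕ, ∀ i ∈ s, ¬ Dominates (f i) g := by
  have hlt : Cardinal.mk (f '' s) < dominatingNumber := by
    have := (Cardinal.mk_image_le_lift (f := f) (s := s)).trans_lt
      (by simpa using hs)
    simpa using this
  by_contra! hcon
  refine notMem_of_lt_csInf' hlt ⟨f '' s, ?_, rfl⟩
  intro g
  obtain ⟨i, hi, h⟩ := hcon g
  exact ⟨f i, ⟨i, hi, rfl⟩, h⟩

theorem exists_dominates_seq (e : ℕ → ℕ → ℕ) : ∃ g : ℕ → ℕ, ∀ i, ∃ N, ∀ n ≥ N, e i n < g n := by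
  refine ⟨fun n => 1 + ∑ i ∈ Finset.range (n + 1), e i n, fun i => ⟨i, fun n hn => ?_⟩⟩
  have := Finset.single_le_sum (f := fun i => e i n) (s := Finset.range (n + 1))
    (fun _ _ => Nat.zero_le _) (Finset.mem_range.2 (by omega : i < n + 1))
  exact Nat.lt_one_add_iff.2 this

theorem aleph0_lt_boundingNumber : Cardinal.aleph0 < boundingNumber := by
  obtain ⟨F, hF, hcard⟩ := exists_boundingNumber
  by_contra hle
  rw [not_lt, ← hcard, Cardinal.mk_le_aleph0_iff] at hle
  apply hF
  rcases F.eq_empty_or_nonempty with rfl | hne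
  · exact ⟨fun _ => 0, by simp⟩
  · obtain ⟨e, rfl⟩ := (show F.Countable from hle).exists_eq_range hne
    obtain ⟨g, hg⟩ := exists_dominates_seq e
    refine ⟨g, ?_⟩
    rintro _ ⟨i, rfl⟩
    obtain ⟨N, hN⟩ := hg i
    exact dominates_iff.2 ⟨N, fun n hn => (hN n hn).le⟩

theorem aleph0_lt_dominatingNumber : Cardinal.aleph0 < dominatingNumber := by
  obtain ⟨F, hF, hcard⟩ := exists_dominatingNumber
  by_contra hle
  rw [not_lt, ← hcard, Cardinal.mk_le_aleph0_iff] at hle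
  obtain ⟨f₀, hf₀, -⟩ := hF fun _ => 0
  obtain ⟨e, rfl⟩ := (show F.Countable from hle).exists_eq_range ⟨f₀, hf₀⟩
  obtain ⟨g, hg⟩ := exists_dominates_seq e
  obtain ⟨_, ⟨i, rfl⟩, hi⟩ := hF g
  obtain ⟨N, hN⟩ := hg i
  obtain ⟨N', hN'⟩ := dominates_iff.1 hi
  exact absurd (hN _ (le_max_left N N')) (not_lt.2 (hN' _ (le_max_right N N')))

/-! ### Each of the three conditions suffices -/

theorem IsDominating.of_uniform {V : Type u} {G : SimpleGraph V}
    (h : ContainsUniformSubdivision G) : IsDominating G := by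
  classical
  obtain ⟨H, hH, r, hr, hunif⟩ := h
  obtain ⟨par, dep, μ, hS⟩ := exists_isRootedSubdivision hH hr
  obtain ⟨L, hL⟩ := hS.exists_ray_of_uniform fun x c c' hx hc hc' =>
    hS.eq_of_isUniform hunif hx hc hc'
  refine isDominating_of_monotone (fun v => if hv : v ∈ H.verts then L ⟨v, hv⟩ else 0)
    fun f hf => ?_
  obtain ⟨R, hR, hfR⟩ := hL f hf
  refine ⟨_, hR.of_subgraph, 1, fun n hn => ?_⟩
  obtain ⟨m, rfl⟩ := Nat.exists_eq_add_of_le' hn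
  simpa using hfR m

theorem exists_label_of_disjoint {V : Type u} {ι : Type*} {S : ι → Set V}
    (hS : Pairwise fun i j => Disjoint (S i) (S j)) (L : ι → V → ℕ) :
    ∃ L' : V → ℕ, ∀ i, ∀ v ∈ S i, L' v = L i v := by
  classical
  refine ⟨fun v => if h : ∃ i, v ∈ S i then L h.choose v else 0, fun i v hv => ?_⟩
  have h : ∃ i, v ∈ S i := ⟨i, hv⟩
  have hi : h.choose = i := by
    by_contra hne
    exact Set.disjoint_left.1 (hS hne) h.choose_spec hv
  simp only [dif_pos h, hi]

theorem IsDominating.of_disjointSubdivisions {V : Type u} {G : SimpleGraph V}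
    (h : ContainsDisjointSubdivisions G boundingNumber) : IsDominating G := by
  classical
  obtain ⟨ι, H, hι, hH, hdisj⟩ := h
  obtain ⟨F, hF, hcard⟩ := exists_boundingNumber
  obtain ⟨e⟩ := Cardinal.eq.1 (hι.trans hcard.symm)
  have hex : ∀ i, ∃ L : V → ℕ, ∀ f, Monotone f → ¬ Dominates f (majorant (e i).1) →
      ∃ R : ℕ → V, IsRay G R ∧ (∀ n, R n ∈ (H i).verts) ∧ ∀ n, f (n + 1) ≤ L (R (n + 1)) := by
    intro i
    obtain ⟨r, hr⟩ := (hH i).exists_isBranch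
    obtain ⟨par, dep, μ, hS⟩ := exists_isRootedSubdivision (hH i) hr
    obtain ⟨L, hL⟩ := hS.exists_ray_of_not_dominated (majorant_monotone (e i).1)
    refine ⟨fun v => if hv : v ∈ (H i).verts then L ⟨v, hv⟩ else 0, fun f hf hd => ?_⟩
    obtain ⟨R, hR, hfR⟩ := hL f hf hd
    exact ⟨_, hR.of_subgraph, fun n => (R n).2, fun n => by simpa using hfR n⟩
  choose L hL using hex
  obtain ⟨L', hL'⟩ := exists_label_of_disjoint hdisj L
  refine isDominating_of_monotone L' fun f hf => ?_
  -- If `f` dominated all these majorants, it would bound the unbounded family `F`.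
  obtain ⟨i, hi⟩ : ∃ i, ¬ Dominates f (majorant (e i).1) := by
    by_contra! hcon
    refine hF ⟨f, fun g hg => ?_⟩
    obtain ⟨N, hN⟩ := dominates_iff.1 (hcon (e.symm ⟨g, hg⟩))
    refine dominates_iff.2 ⟨N, fun n hn => le_trans ?_ (hN n hn)⟩
    simpa using le_majorant g n
  obtain ⟨R, hR, hRH, hfR⟩ := hL i f hf hi
  refine ⟨R, hR, 1, fun n hn => ?_⟩
  obtain ⟨m, rfl⟩ := Nat.exists_eq_add_of_le' hn
  rw [hL' i _ (hRH _)]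
  exact hfR m

theorem IsDominating.of_disjointRays {V : Type u} {G : SimpleGraph V}
    (h : ContainsDisjointRays G dominatingNumber) : IsDominating G := by
  classical
  obtain ⟨ι, R, hι, hR, hdisj⟩ := h
  obtain ⟨F, hF, hcard⟩ := exists_dominatingNumber
  obtain ⟨e⟩ := Cardinal.eq.1 (hι.trans hcard.symm)
  obtain ⟨L, hL⟩ := exists_label_of_disjoint hdisj fun i v =>
    (e i).1 (Function.invFun (R i) v)
  refine ⟨L, fun g => ?_⟩
  obtain ⟨f, hf, hd⟩ := hF g
  refine ⟨f, ⟨R (e.symm ⟨f, hf⟩), hR _, ?_⟩, hd⟩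
  funext n
  rw [Function.comp_apply, hL _ _ ⟨n, rfl⟩, Function.leftInverse_invFun (hR _).1 n]
  simp

/-! ### Assembling subdivisions from fans of paths -/

theorem exists_seq_of_extension {E : Type u} [Inhabited E] (P : ℕ → (ℕ → E) → Prop)
    (hloc : ∀ n e e', (∀ m ≤ n, e m = e' m) → P n e → P n e')
    (hext : ∀ n e, (∀ m < n, P m e) → ∃ x, P n (Function.update e n x)) :
    ∃ e, ∀ n, P n e := by
  classical
  have hstep : ∀ n (e : ℕ → E), ∃ x, (∀ m < n, P m e) → P n (Function.update e n x) := by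
    intro n e
    by_cases h : ∀ m < n, P m e
    · obtain ⟨x, hx⟩ := hext n e h
      exact ⟨x, fun _ => hx⟩
    · exact ⟨default, fun h' => absurd h' h⟩
  choose x hx using hstep
  let S : ℕ → ℕ → E := fun n => Nat.rec (fun _ => default)
    (fun n e => Function.update e n (x n e)) n
  have hS : ∀ n, S (n + 1) = Function.update (S n) n (x n (S n)) := fun _ => rfl
  have hstable : ∀ n k m, m < n → S (n + k) m = S n m := by
    intro n k m hm
    induction k with
    | zero => rfl
    | succ k ih =>
      rw [← add_assoc, hS, Function.update_of_ne (by omega), ih]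
  have hall : ∀ n, ∀ m < n, P m (S n) := by
    intro n
    induction n with
    | zero => intro m hm; omega
    | succ n ih =>
      intro m hm
      rcases Nat.lt_succ_iff_lt_or_eq.1 hm with h | rfl
      · exact hloc m (S n) _ (fun j hj => (hstable n 1 j (by omega)).symm) (ih m h)
      · rw [hS]
        exact hx _ _ ih
  refine ⟨fun n => S (n + 1) n, fun n => hloc n (S (n + 1)) _ (fun m hm => ?_)
    (hall (n + 1) n (Nat.lt_succ_self n))⟩
  obtain ⟨k, rfl⟩ := Nat.exists_eq_add_of_le hm
  have := hstable (m + 1) k m (by omega)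
  rwa [show m + 1 + k = m + k + 1 by omega] at this

/-- A system of segments `e n 0, …, e n (len n)`, where segment `n ≥ 1` starts at the end of
segment `s n` and is otherwise disjoint from the others; segment `0` is a single vertex. -/
structure IsSegmentTree {V : Type u} (G : SimpleGraph V) (s len : ℕ → ℕ) (e : ℕ → ℕ → V) :
    Prop where
  lt : ∀ n, n ≠ 0 → s n < n
  infinite : ∀ k, {n | n ≠ 0 ∧ s n = k}.Infinite
  len_zero : len 0 = 0
  len_pos : ∀ n, n ≠ 0 → 1 ≤ len n
  start : ∀ n, n ≠ 0 → e n 0 = e (s n) (len (s n))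
  adj : ∀ n i, i < len n → G.Adj (e n i) (e n (i + 1))
  inj : ∀ n i m j, i ≤ len n → j ≤ len m → (i = 0 → n = 0) → (j = 0 → m = 0) →
    e n i = e m j → n = m ∧ i = j

namespace IsSegmentTree

variable {V : Type u} {G : SimpleGraph V} {s len : ℕ → ℕ} {e : ℕ → ℕ → V}

/-- The subgraph formed by the segments. -/
def subgraph (h : IsSegmentTree G s len e) : G.Subgraph where
  verts := {v | ∃ n i, i ≤ len n ∧ e n i = v}
  Adj u v := ∃ n i, i < len n ∧ ((u = e n i ∧ v = e n (i + 1)) ∨ (v = e n i ∧ u = e n (i + 1)))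
  adj_sub := by
    rintro u v ⟨n, i, hi, ⟨rfl, rfl⟩ | ⟨rfl, rfl⟩⟩
    · exact h.adj n i hi
    · exact (h.adj n i hi).symm
  edge_vert := by
    rintro u v ⟨n, i, hi, ⟨rfl, rfl⟩ | ⟨rfl, rfl⟩⟩
    · exact ⟨n, i, hi.le, rfl⟩
    · exact ⟨n, i + 1, hi, rfl⟩
  symm := ⟨by
    rintro u v ⟨n, i, hi, h⟩
    exact ⟨n, i, hi, h.symm⟩⟩

/-- Reindexing the start of a segment as the end of its predecessor makes indices unique. -/
theorem exists_index (h : IsSegmentTree G s len e) (w : h.subgraph.verts) :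
    ∃ n i, i ≤ len n ∧ (i = 0 → n = 0) ∧ e n i = w := by
  obtain ⟨w, n, i, hi, rfl⟩ := w
  by_cases hi0 : i = 0 ∧ n ≠ 0
  · obtain ⟨rfl, hn⟩ := hi0
    refine ⟨s n, len (s n), le_rfl, fun h0 => ?_, (h.start n hn).symm⟩
    by_contra hs
    have := h.len_pos _ hs
    omega
  · exact ⟨n, i, hi, fun h0 => by tauto, rfl⟩

theorem exists_isRootedSubdivision (h : IsSegmentTree G s len e) :
    ∃ (r : h.subgraph.verts) (par : h.subgraph.verts → h.subgraph.verts)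
      (dep μ : h.subgraph.verts → ℕ), IsRootedSubdivision h.subgraph.coe r par dep μ ∧
      ∀ v c, μ v = 0 → c ∈ children r par v →
        ∃ n, n ≠ 0 ∧ (v : V) = e n 0 ∧ μ c + 1 = len n := by
  classical
  choose N I hI hI0 hNI using h.exists_index
  have hN : ∀ (w : h.subgraph.verts) n i, i ≤ len n → (i = 0 → n = 0) → e n i = (w : V) → N w = n ∧ I w = i :=
    fun w n i hi hi0 hw =>
      h.inj _ _ _ _ (hI w) hi (hI0 w) hi0 ((hNI w).trans hw.symm)
  have hext : ∀ w w', N w = N w' → I w = I w' → w = w' := fun w w' h1 h2 =>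
    Subtype.ext (by rw [← hNI w, ← hNI w', h1, h2])
  let mk : ∀ n i, i ≤ len n → h.subgraph.verts := fun n i hi => ⟨e n i, n, i, hi, rfl⟩
  -- `D n` is the depth of the first vertex of segment `n`.
  obtain ⟨D, hD⟩ := exists_seq_of_extension (E := ℕ)
    (fun n D => D n = if n = 0 then 0 else D (s n) + len (s n))
    (fun n D D' hDD' hD => by
      by_cases hn : n = 0
      · subst hn
        rw [← hDD' 0 le_rfl, hD]
        simp
      · rw [← hDD' n le_rfl, ← hDD' (s n) (h.lt n hn).le, hD])
    (fun n D _ => by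
      by_cases hn : n = 0
      · exact ⟨0, by simp [hn]⟩
      · exact ⟨D (s n) + len (s n), by
          rw [Function.update_self, if_neg hn, Function.update_of_ne (h.lt n hn).ne]⟩)
  let r : h.subgraph.verts := mk 0 0 (Nat.zero_le _)
  let par : h.subgraph.verts → h.subgraph.verts := fun w =>
    mk (N w) (I w - 1) ((Nat.sub_le _ _).trans (hI w))
  have hr : N r = 0 ∧ I r = 0 := hN r 0 0 (Nat.zero_le _) (fun _ => rfl) rfl
  have hroot : ∀ w, I w = 0 → w = r := fun w hw =>
    hext w r ((hI0 w hw).trans hr.1.symm) (hw.trans hr.2.symm)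
  have hpos : ∀ w, w ≠ r → 1 ≤ I w ∧ N w ≠ 0 := by
    intro w hw
    have h1 : I w ≠ 0 := mt (hroot w) hw
    refine ⟨by omega, fun h0 => ?_⟩
    have := hI w
    rw [h0, h.len_zero] at this
    omega
  have hpar : ∀ w, w ≠ r → (2 ≤ I w ∧ N (par w) = N w ∧ I (par w) = I w - 1) ∨
      (I w = 1 ∧ N (par w) = s (N w) ∧ I (par w) = len (s (N w))) := by
    intro w hw
    obtain ⟨h1, h2⟩ := hpos w hw
    have h3 := hI w
    by_cases h4 : I w = 1
    · refine Or.inr ⟨h4, hN (par w) _ _ le_rfl (fun h0 => ?_) ?_⟩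
      · by_contra hs
        have := h.len_pos _ hs
        omega
      · rw [← h.start _ h2]
        show _ = e (N w) (I w - 1)
        rw [h4]
    · exact Or.inl ⟨by omega, hN (par w) _ _ (by omega) (fun h0 => by omega) rfl⟩
  have hmk : ∀ n i (hi : i + 1 ≤ len n), mk n (i + 1) hi ≠ r ∧
      par (mk n (i + 1) hi) = mk n i (by omega) ∧ N (mk n (i + 1) hi) = n ∧
      I (mk n (i + 1) hi) = i + 1 := by
    intro n i hi
    obtain ⟨h1, h2⟩ := hN (mk n (i + 1) hi) n (i + 1) hi (fun h0 => by omega) rfl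
    refine ⟨fun h0 => ?_, Subtype.ext ?_, h1, h2⟩
    · rw [h0, hr.2] at h2
      omega
    · show e (N (mk n (i + 1) hi)) (I (mk n (i + 1) hi) - 1) = e n i
      rw [h1, h2]
      rfl
  refine ⟨r, par, fun w => D (N w) + I w, fun w => len (N w) - I w, ⟨⟨?_, ?_, ?_⟩, ?_, ?_, ?_, ?_, ?_⟩, ?_⟩
  · show D (N r) + I r = 0
    rw [hr.1, hr.2, hD 0]
    simp
  · intro w hw
    show D (N w) + I w = D (N (par w)) + I (par w) + 1
    rcases hpar w hw with ⟨h1, h2, h3⟩ | ⟨h1, h2, h3⟩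
    · rw [h2, h3]
      omega
    · rw [h2, h3, h1, hD (N w), if_neg (hpos w hw).2]
  · intro u v
    constructor
    · rintro ⟨n, i, hi, ⟨hu, hv⟩ | ⟨hv, hu⟩⟩
      · obtain rfl : v = mk n (i + 1) hi := Subtype.ext hv
        exact Or.inl ⟨(hmk n i hi).1, (Subtype.ext hu : u = mk n i hi.le).trans
          (hmk n i hi).2.1.symm⟩
      · obtain rfl : u = mk n (i + 1) hi := Subtype.ext hu
        exact Or.inr ⟨(hmk n i hi).1, (Subtype.ext hv : v = mk n i hi.le).trans
          (hmk n i hi).2.1.symm⟩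
    · have key : ∀ w, w ≠ r → ∃ n i, i < len n ∧ ((par w : V) = e n i ∧ (w : V) = e n (i + 1)) := by
        intro w hw
        have h1 := (hpos w hw).1
        have h2 := hI w
        refine ⟨N w, I w - 1, by omega, rfl, ?_⟩
        rw [show I w - 1 + 1 = I w by omega]
        exact (hNI w).symm
      rintro (⟨hv, rfl⟩ | ⟨hu, rfl⟩)
      · obtain ⟨n, i, hi, h1⟩ := key v hv
        exact ⟨n, i, hi, Or.inl h1⟩
      · obtain ⟨n, i, hi, h1⟩ := key u hu
        exact ⟨n, i, hi, Or.inr h1⟩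
  · show len (N r) - I r = 0
    rw [hr.1, hr.2, h.len_zero]
  · rintro v c ⟨hc, rfl⟩ hv
    have hc2 := hI c
    show len (N c) - I c + 1 = len (N (par c)) - I (par c)
    rcases hpar c hc with ⟨h1, h2, h3⟩ | ⟨h1, h2, h3⟩
    · rw [h2, h3]
      omega
    · rw [h2, h3] at hv
      omega
  · intro v hv
    have hv' : I v + 1 ≤ len (N v) := by omega
    obtain ⟨h1, h2, h3, h4⟩ := hmk (N v) (I v) hv'
    refine ⟨mk (N v) (I v + 1) hv', ⟨h1, h2.trans (Subtype.ext (hNI v))⟩, ?_⟩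
    rintro c ⟨hc, rfl⟩
    have hc2 := hI c
    rcases hpar c hc with ⟨h5, h6, h7⟩ | ⟨h5, h6, h7⟩
    · refine hext _ _ (h6.symm.trans h3.symm) (Eq.trans ?_ h4.symm)
      omega
    · rw [h6, h7] at hv
      omega
  · intro v hv
    have hv' : I v = len (N v) := by have := hI v; omega
    have hmaps : ∀ n ∈ {n | n ≠ 0 ∧ s n = N v}, ∃ c ∈ children r par v, N c = n := by
      rintro n ⟨hn, hs⟩
      obtain ⟨h1, h2, h3, h4⟩ := hmk n 0 (h.len_pos n hn)
      refine ⟨_, ⟨h1, h2.trans (Subtype.ext ?_)⟩, h3⟩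
      show e n 0 = v
      rw [h.start n hn, hs, ← hv', hNI]
    intro hfin
    refine h.infinite (N v) ((hfin.image N).subset fun n hn => ?_)
    obtain ⟨c, hc, hcn⟩ := hmaps n hn
    exact ⟨c, hc, hcn⟩
  · intro v _
    have : Function.Injective fun w => (N w, I w) := fun w w' hw =>
      hext w w' (congrArg Prod.fst hw) (congrArg Prod.snd hw)
    have := this.countable
    exact Set.to_countable _
  · rintro v c hv ⟨hc, rfl⟩
    have hc2 := hI c
    change len (N (par c)) - I (par c) = 0 at hv
    change ∃ n, n ≠ 0 ∧ (par c : V) = e n 0 ∧ len (N c) - I c + 1 = len n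
    rcases hpar c hc with ⟨h1, h2, h3⟩ | ⟨h1, h2, h3⟩
    · rw [h2, h3] at hv
      omega
    · refine ⟨N c, (hpos c hc).2, ?_, by omega⟩
      show e (N c) (I c - 1) = e (N c) 0
      rw [h1]

end IsSegmentTree

/-- `p 0, …, p ℓ` is a walk of `G` within `Z` from `x` to a vertex of `X`, of length `ℓ ≥ 1`,
which avoids `F` except perhaps at its first vertex. -/
structure IsFanWalk {V : Type u} (G : SimpleGraph V) (X Z : Set V) (F : Finset V) (x : V) (ℓ : ℕ)
    (p : ℕ → V) : Prop where
  pos : 1 ≤ ℓ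
  start : p 0 = x
  finish : p ℓ ∈ X
  adj : ∀ i < ℓ, G.Adj (p i) (p (i + 1))
  mem : ∀ i ≤ ℓ, p i ∈ Z
  avoid : ∀ i, 1 ≤ i → i ≤ ℓ → p i ∉ F

/-- A fan walk that is a path. -/
structure IsFanPath {V : Type u} (G : SimpleGraph V) (X Z : Set V) (F : Finset V) (x : V) (ℓ : ℕ)
    (p : ℕ → V) : Prop extends IsFanWalk G X Z F x ℓ p where
  inj : ∀ i j, i < j → j ≤ ℓ → p i ≠ p j

theorem exists_isSegmentTree {V : Type u} {G : SimpleGraph V} {X Z : Set V} (hX : X.Nonempty)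
    {A : V → Set ℕ} (hfan : ∀ x ∈ X, ∀ F : Finset V, ∃ ℓ ∈ A x, ∃ p, IsFanPath G X Z F x ℓ p) :
    ∃ s len e, IsSegmentTree G s len e ∧ (∀ n i, i ≤ len n → e n i ∈ Z) ∧
      ∀ n, n ≠ 0 → len n ∈ A (e n 0) := by
  classical
  obtain ⟨r, hr⟩ := hX
  have hV : Inhabited V := ⟨r⟩
  -- This bookkeeping returns to every earlier segment infinitely often, so each endpoint gets
  -- infinitely many children.
  let s : ℕ → ℕ := fun n => (n - 1).unpair.1
  have hs : ∀ n, n ≠ 0 → s n < n := by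
    intro n hn
    have : s n ≤ n - 1 := Nat.unpair_left_le _
    omega
  have hsinf : ∀ k, {n | n ≠ 0 ∧ s n = k}.Infinite := by
    intro k
    have hinj : Function.Injective fun j => Nat.pair k j + 1 := by
      intro i j hij
      have : Nat.pair k i = Nat.pair k j := Nat.succ_injective hij
      exact (Nat.pair_eq_pair.1 this).2
    refine (Set.infinite_range_of_injective hinj).mono ?_
    rintro _ ⟨j, rfl⟩
    refine ⟨Nat.succ_ne_zero _, ?_⟩
    simp [s]
  let fin : (ℕ → ℕ × (ℕ → V)) → ℕ → V := fun e n => (e n).2 (e n).1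
  let Fs : (ℕ → ℕ × (ℕ → V)) → ℕ → Finset V := fun e n =>
    (Finset.range n).biUnion fun k => (Finset.range ((e k).1 + 1)).image (e k).2
  have hFs : ∀ (e e' : ℕ → ℕ × (ℕ → V)) n, (∀ m < n, e m = e' m) → Fs e n = Fs e' n := by
    intro e e' n h
    refine Finset.biUnion_congr rfl fun k hk => ?_
    rw [h k (Finset.mem_range.1 hk)]
  -- Segment `n` starts at the end of segment `s n` and avoids the finite set `Fs e n` of vertices
  -- used so far. It ends in `X`, so it can be extended in turn.
  obtain ⟨e, he⟩ := exists_seq_of_extension (E := ℕ × (ℕ → V))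
    (fun n e => fin e n ∈ X ∧ (n = 0 → e 0 = (0, fun _ => r)) ∧
      (n ≠ 0 → (e n).1 ∈ A (fin e (s n)) ∧
        IsFanPath G X Z (Fs e n) (fin e (s n)) (e n).1 (e n).2))
    (fun n e e' hee ⟨h1, h2, h3⟩ => by
      refine ⟨?_, fun hn => ?_, fun hn => ?_⟩
      · show (e' n).2 (e' n).1 ∈ X
        rw [← hee n le_rfl]
        exact h1
      · rw [← hee 0 (Nat.zero_le _)]
        exact h2 hn
      · have h4 : fin e' (s n) = fin e (s n) := by
          show (e' _).2 (e' _).1 = (e _).2 (e _).1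
          rw [hee _ (hs n hn).le]
        rw [h4, ← hee n le_rfl, ← hFs e e' n fun m hm => hee m hm.le]
        exact h3 hn)
    (fun n e ih => by
      by_cases hn : n = 0
      · subst hn
        exact ⟨(0, fun _ => r), by simpa [fin] using hr, fun _ => by simp, fun h => absurd rfl h⟩
      · obtain ⟨ℓ, hℓ, p, hp⟩ := hfan _ (ih (s n) (hs n hn)).1 (Fs e n)
        have h4 : ∀ x, fin (Function.update e n x) (s n) = fin e (s n) := fun x => by
          simp only [fin, Function.update_of_ne (hs n hn).ne]
        have h5 : ∀ x, Fs (Function.update e n x) n = Fs e n := fun x =>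
          hFs _ _ _ fun m hm => Function.update_of_ne hm.ne _ _
        refine ⟨(ℓ, p), ?_, fun h => absurd h hn, fun _ => ?_⟩
        · simpa [fin] using hp.finish
        · rw [h4, h5, Function.update_self]
          exact ⟨hℓ, hp⟩)
  have he0 : e 0 = (0, fun _ => r) := (he 0).2.1 rfl
  have hseg : ∀ n, n ≠ 0 → IsFanPath G X Z (Fs e n) (fin e (s n)) (e n).1 (e n).2 :=
    fun n hn => ((he n).2.2 hn).2
  have hlt : ∀ n m i j, m < n → i ≤ (e n).1 → j ≤ (e m).1 → (i = 0 → n = 0) →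
      (e n).2 i ≠ (e m).2 j := by
    intro n m i j hmn hi hj hi0 heq
    refine (hseg n (by omega)).avoid i (by by_contra; have := hi0 (by omega); omega) hi ?_
    rw [heq]
    exact Finset.mem_biUnion.2 ⟨m, Finset.mem_range.2 hmn,
      Finset.mem_image_of_mem _ (Finset.mem_range.2 (by omega))⟩
  refine ⟨s, fun n => (e n).1, fun n => (e n).2, ⟨hs, hsinf, by rw [he0], fun n hn =>
    (hseg n hn).pos, fun n hn => (hseg n hn).start, fun n i hi => ?_, ?_⟩, fun n i hi => ?_,
    fun n hn => ?_⟩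
  · by_cases hn : n = 0
    · subst hn
      rw [he0] at hi
      exact absurd hi (Nat.not_lt_zero _)
    · exact (hseg n hn).adj i hi
  · intro n i m j hi hj hi0 hj0 heq
    rcases lt_trichotomy n m with h | rfl | h
    · exact absurd heq.symm (hlt m n j i h hj hi hj0)
    · refine ⟨rfl, ?_⟩
      by_cases hn : n = 0
      · subst hn
        rw [he0] at hi hj
        exact (Nat.le_zero.1 hi).trans (Nat.le_zero.1 hj).symm
      · rcases lt_trichotomy i j with h | h | h
        · exact absurd heq ((hseg n hn).inj i j h hj)
        · exact h
        · exact absurd heq.symm ((hseg n hn).inj j i h hi)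
    · exact absurd heq (hlt n m i j h hi hj hi0)
  · by_cases hn : n = 0
    · subst hn
      obtain ⟨ℓ, -, p, hp⟩ := hfan r hr ∅
      have := hp.mem 0 (Nat.zero_le _)
      rw [hp.start] at this
      simpa [he0] using this
    · exact (hseg n hn).mem i hi
  · show (e n).1 ∈ A ((e n).2 0)
    rw [(hseg n hn).start]
    exact ((he n).2.2 hn).1

/-- If every vertex of `X` sends infinitely many paths with admissible lengths to `X`, disjoint
except at their start, then these can be arranged into a subdivision of `T_ω`. -/
theorem exists_rootedSubdivision_of_fan {V : Type u} {G : SimpleGraph V} {X Z : Set V}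
    (hX : X.Nonempty) {A : V → Set ℕ}
    (hfan : ∀ x ∈ X, ∀ F : Finset V, ∃ ℓ ∈ A x, ∃ p, IsFanPath G X Z F x ℓ p) :
    ∃ (H : G.Subgraph) (r : H.verts) (par : H.verts → H.verts) (dep μ : H.verts → ℕ),
      IsRootedSubdivision H.coe r par dep μ ∧ H.verts ⊆ Z ∧ H.verts.Countable ∧
      ∀ v c, μ v = 0 → c ∈ children r par v → μ c + 1 ∈ A v := by
  obtain ⟨s, len, e, h, hZ, hA⟩ := exists_isSegmentTree hX hfan
  obtain ⟨r, par, dep, μ, hS, hμ⟩ := h.exists_isRootedSubdivision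
  refine ⟨h.subgraph, r, par, dep, μ, hS, ?_, ?_, ?_⟩
  · rintro _ ⟨n, i, hi, rfl⟩
    exact hZ n i hi
  · refine (Set.countable_range fun x : ℕ × ℕ => e x.1 x.2).mono ?_
    rintro _ ⟨n, i, hi, rfl⟩
    exact ⟨(n, i), rfl⟩
  · intro v c hv hc
    obtain ⟨n, hn, h1, h2⟩ := hμ v c hv hc
    rw [h2, h1]
    exact hA n hn

theorem IsFanWalk.mono {V : Type u} {G : SimpleGraph V} {X X' Z : Set V} {F F' : Finset V} {x : V}
    {ℓ : ℕ} {p : ℕ → V} (h : IsFanWalk G X Z F x ℓ p) (hX : X ⊆ X') (hF : F' ⊆ F) :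
    IsFanWalk G X' Z F' x ℓ p :=
  ⟨h.pos, h.start, hX h.finish, h.adj, h.mem, fun i h1 h2 h3 => h.avoid i h1 h2 (hF h3)⟩

/-- Cut out closed detours. As `x ∈ F`, the walk never returns to `x`, so its length stays positive.
-/
theorem IsFanWalk.exists_isFanPath {V : Type u} {G : SimpleGraph V} {X Z : Set V} {F : Finset V}
    {x : V} {ℓ : ℕ} {p : ℕ → V} (h : IsFanWalk G X Z F x ℓ p) (hx : x ∈ F) :
    ∃ ℓ' ≤ ℓ, ∃ p', IsFanPath G X Z F x ℓ' p' := by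
  induction ℓ using Nat.strong_induction_on generalizing p with
  | _ ℓ ih =>
    by_cases hinj : ∀ i j, i < j → j ≤ ℓ → p i ≠ p j
    · exact ⟨ℓ, le_rfl, p, h, hinj⟩
    · push Not at hinj
      obtain ⟨i, j, hij, hj, heq⟩ := hinj
      have hi : 1 ≤ i := by
        by_contra hi
        have hi0 : i = 0 := by omega
        subst hi0
        rw [h.start] at heq
        exact h.avoid j (by omega) hj (heq ▸ hx)
      obtain ⟨ℓ', hℓ', p', hp'⟩ := ih (ℓ - (j - i)) (by omega)
        (p := fun n => if n ≤ i then p n else p (n + (j - i))) (by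
          refine ⟨by omega, ?_, ?_, fun n hn => ?_, fun n hn => ?_, fun n h1 h2 => ?_⟩
          · simpa using h.start
          · split_ifs with h1
            · rw [show ℓ - (j - i) = i by omega, heq, show j = ℓ by omega]
              exact h.finish
            · rw [show ℓ - (j - i) + (j - i) = ℓ by omega]
              exact h.finish
          · rcases lt_trichotomy n i with h1 | rfl | h1
            · rw [if_pos (by omega), if_pos (by omega)]
              exact h.adj n (by omega)
            · rw [if_pos le_rfl, if_neg (by omega), heq,
                show n + 1 + (j - n) = j + 1 by omega]
              exact h.adj j (by omega)
            · rw [if_neg (by omega), if_neg (by omega),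
                show n + 1 + (j - i) = n + (j - i) + 1 by omega]
              exact h.adj _ (by omega)
          · split_ifs
            · exact h.mem _ (by omega)
            · exact h.mem _ (by omega)
          · split_ifs
            · exact h.avoid _ h1 (by omega)
            · exact h.avoid _ (by omega) (by omega))
      exact ⟨ℓ', by omega, p', hp'⟩

/-! ### Ranks and rays in subdivision-free sets -/

/-- A graph without subdivisions of `T_ω` inside `Z` has a rank function such that every vertex
can be separated by finitely many vertices from all vertices of at least the same rank. -/
theorem exists_rank {V : Type u} {G : SimpleGraph V} {Z : Set V}
    (hno : ∀ H : G.Subgraph, IsSubdivision H.coe → H.verts.Countable → ¬ H.verts ⊆ Z) :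
    ∃ (ρ : V → Ordinal.{u}) (S : V → Finset V),
      ∀ x ℓ p, ¬ IsFanWalk G {y | ρ x ≤ ρ y} Z (S x) x ℓ p := by
  classical
  -- `Γ` adds the vertices that finitely many vertices separate from the complement of `B`. The rank
  -- is the stage of entry into its least fixed point, outside which the fan construction would
  -- yield a subdivision.
  let Γ : Set V →o Set V := ⟨fun B => {x | ∃ F : Finset V, ∀ ℓ p, ¬ IsFanWalk G Bᶜ Z F x ℓ p},
    fun B B' hB x ⟨F, hF⟩ => ⟨F, fun ℓ p h =>
      hF ℓ p (h.mono (Set.compl_subset_compl.2 hB) (Finset.Subset.refl _))⟩⟩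
  have hlfp : ∀ x, x ∈ Γ.lfp := by
    by_contra! hne
    obtain ⟨H, r, par, dep, μ, hS, hZ, hc, -⟩ := exists_rootedSubdivision_of_fan
      (G := G) (X := (Γ.lfp)ᶜ) (Z := Z) hne (A := fun _ => Set.univ) (by
        intro x hx F
        have hx' : x ∉ Γ Γ.lfp := by rwa [OrderHom.map_lfp]
        have : ∃ ℓ p, IsFanWalk G (Γ.lfp)ᶜ Z (insert x F) x ℓ p := by
          by_contra! hcon
          exact hx' ⟨_, hcon⟩
        obtain ⟨ℓ, p, hp⟩ := this
        obtain ⟨ℓ', -, p', hp'⟩ := hp.exists_isFanPath (Finset.mem_insert_self x F)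
        exact ⟨ℓ', trivial, p', hp'.mono subset_rfl (Finset.subset_insert x F), hp'.inj⟩)
    exact hno H hS.isSubdivision hc hZ
  obtain ⟨a, ha⟩ := OrdinalApprox.lfp_mem_range_lfpApprox Γ
  have hne : ∀ x, {b | x ∈ OrdinalApprox.lfpApprox Γ ⊥ b}.Nonempty := fun x =>
    ⟨a, show x ∈ OrdinalApprox.lfpApprox Γ ⊥ a by rw [ha]; exact hlfp x⟩
  let ρ : V → Ordinal.{u} := fun x => sInf {b | x ∈ OrdinalApprox.lfpApprox Γ ⊥ b}
  have hρ : ∀ x, ∃ F : Finset V, ∀ ℓ p, ¬ IsFanWalk G {y | ρ x ≤ ρ y} Z F x ℓ p := by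
    intro x
    have hmem : x ∈ OrdinalApprox.lfpApprox Γ ⊥ (ρ x) := csInf_mem (hne x)
    rw [OrdinalApprox.lfpApprox] at hmem
    have : ∃ b < ρ x, x ∈ Γ (OrdinalApprox.lfpApprox Γ ⊥ b) := by
      simpa using hmem
    obtain ⟨b, hb, F, hF⟩ := this
    refine ⟨F, fun ℓ p h => hF ℓ p (h.mono (fun y hy hyb => ?_) (Finset.Subset.refl _))⟩
    have h1 : ρ y ≤ b := csInf_le' hyb
    exact absurd (hb.trans_le hy) (not_lt.2 h1)
  choose S hS using hρ
  exact ⟨ρ, S, hS⟩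

/-- Start where the sequence stays below its least eventual strict upper bound, if one exists. -/
theorem exists_tail_recurrent {α : Type*} [LinearOrder α] [WellFoundedLT α] (a : ℕ → α) :
    ∃ m₀, ∀ n ≥ m₀, ∀ N, ∃ n' ≥ N, a n ≤ a n' := by
  by_cases h : ∃ c, ∃ N, ∀ n ≥ N, a n < c
  · obtain ⟨N, hN⟩ := WellFounded.min_mem wellFounded_lt {c | ∃ N, ∀ n ≥ N, a n < c} h
    refine ⟨N, fun n hn M => ?_⟩
    by_contra! hcon
    exact WellFounded.not_lt_min wellFounded_lt {c | ∃ N, ∀ n ≥ N, a n < c} ⟨M, hcon⟩ (hN n hn)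
  · push Not at h
    exact ⟨0, fun n _ N => h (a n) N⟩

theorem exists_low_bound {V : Type u} {G : SimpleGraph V} {Z : Set V}
    (hno : ∀ H : G.Subgraph, IsSubdivision H.coe → H.verts.Countable → ¬ H.verts ⊆ Z)
    (L : V → ℕ) : ∃ c : V → ℕ → ℕ, ∀ R, IsRay G R → (∀ n, R n ∈ Z) →
      ∃ m₀, ∀ m ≥ m₀, ∀ N, ∃ n ≥ N, L (R (m + n)) ≤ c (R m) N := by
  classical
  obtain ⟨ρ, S, hS⟩ := exists_rank hno
  -- The ray returns to rank at least that of its current vertex, so it must meet that vertex's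
  -- separator. Iterating, `N` separator steps from `R m` reach some position at least `N` later.
  let Φ : V → ℕ → Finset V := fun x n => Nat.rec {x} (fun _ B => B ∪ B.biUnion S) n
  refine ⟨fun x n => (Φ x n).sup L, fun R hR hZ => ?_⟩
  obtain ⟨m₀, hm₀⟩ := exists_tail_recurrent fun n => ρ (R n)
  refine ⟨m₀, fun m hm N => ?_⟩
  suffices ∃ n ≥ N, R (m + n) ∈ Φ (R m) N by
    obtain ⟨n, hn, hmem⟩ := this
    exact ⟨n, hn, Finset.le_sup hmem⟩
  induction N with
  | zero => exact ⟨0, le_rfl, Finset.mem_singleton_self _⟩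
  | succ N ih =>
    obtain ⟨n, hn, hmem⟩ := ih
    obtain ⟨n', hn', hle⟩ := hm₀ (m + n) (by omega) (m + n + 1)
    obtain ⟨ℓ, rfl⟩ := Nat.exists_eq_add_of_le hn'
    have := hS (R (m + n)) (ℓ + 1) fun i => R (m + n + i)
    have hhit : ∃ i, 1 ≤ i ∧ R (m + n + i) ∈ S (R (m + n)) := by
      by_contra! hcon
      refine this ⟨by omega, rfl, ?_, fun i _ => hR.2 _, fun i _ => hZ _, fun i h1 _ => hcon i h1⟩
      show ρ (R (m + n)) ≤ ρ (R (m + n + (ℓ + 1)))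
      rwa [show m + n + (ℓ + 1) = m + n + 1 + ℓ by omega]
    obtain ⟨i, hi, hiS⟩ := hhit
    refine ⟨n + i, by omega, Finset.mem_union_right _ (Finset.mem_biUnion.2 ⟨_, hmem, ?_⟩)⟩
    rwa [← add_assoc]

/-- If `Z` spans no subdivision of `T_ω` and fewer than `𝔡` vertices meet all rays in `Z`, then
the rays in `Z` do not form a dominating family. -/
theorem exists_undominated_of_no_subdivision {V : Type u} {G : SimpleGraph V} {Z D : Set V}
    (hno : ∀ H : G.Subgraph, IsSubdivision H.coe → H.verts.Countable → ¬ H.verts ⊆ Z)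
    (hD : Cardinal.mk D < Cardinal.lift.{u} dominatingNumber)
    (hmeet : ∀ R, IsRay G R → (∀ n, R n ∈ Z) → ∃ n, R n ∈ D) (L : V → ℕ) :
    ∃ h : ℕ → ℕ, ∀ R, IsRay G R → (∀ n, R n ∈ Z) → ¬ ∃ N, ∀ n ≥ N, h n ≤ L (R n) := by
  obtain ⟨c, hc⟩ := exists_low_bound hno L
  obtain ⟨h, hh⟩ := exists_not_dominates_of_lt_dominatingNumber hD c
  refine ⟨majorant h, fun R hR hZ ⟨N, hN⟩ => ?_⟩
  obtain ⟨m₀, hm₀⟩ := hc R hR hZ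
  obtain ⟨k, hk⟩ := hmeet (fun n => R (m₀ + n)) ⟨fun i j hij => by
    have := hR.1 hij
    omega, fun n => hR.2 _⟩ fun n => hZ _
  -- A ray dominating `majorant h` would make `c` at its vertex in `D` dominate `h`.
  refine hh _ hk (dominates_iff.2 ⟨N, fun n hn => ?_⟩)
  obtain ⟨n', hn', hle⟩ := hm₀ (m₀ + k) (by omega) n
  calc h n ≤ majorant h n := le_majorant h n
    _ ≤ majorant h (m₀ + k + n') := majorant_monotone h (by omega)
    _ ≤ L (R (m₀ + k + n')) := hN _ (by omega)
    _ ≤ c (R (m₀ + k)) n := hle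

/-! ### Recurrent walks and uniform subdivisions -/

section

variable {V : Type u}

/-- The infinite walks of `G` that meet `U` infinitely often. -/
structure IsRecurrentWalk (G : SimpleGraph V) (U : Set V) (W : ℕ → V) : Prop where
  adj : ∀ n, G.Adj (W n) (W (n + 1))
  recurrent : ∀ N, ∃ n ≥ N, W n ∈ U

theorem IsRecurrentWalk.tail {G : SimpleGraph V} {U : Set V} {W : ℕ → V}
    (h : IsRecurrentWalk G U W) (m : ℕ) : IsRecurrentWalk G U fun n => W (n + m) := by
  refine ⟨fun n => ?_, fun N => ?_⟩
  · have := h.adj (n + m)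
    rwa [show n + m + 1 = n + 1 + m by omega] at this
  · obtain ⟨n, hn, hU⟩ := h.recurrent (N + m)
    refine ⟨n - m, by omega, ?_⟩
    rwa [show n - m + m = n by omega]

/-- Every function is dominated from position `k` on by a recurrent walk within `Y` from `v`. -/
def IsGood (G : SimpleGraph V) (U : Set V) (L : V → ℕ) (Y : Set V) (k : ℕ) (v : V) : Prop :=
  ∀ f : ℕ → ℕ, ∃ W, IsRecurrentWalk G U W ∧ W 0 = v ∧ (∀ n, W n ∈ Y) ∧ ∀ n ≥ k, f n ≤ L (W n)

/-- Like `IsGood`, but moreover the walk can be chosen to avoid any given finite set after its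
first vertex. -/
def IsFanGood (G : SimpleGraph V) (U : Set V) (L : V → ℕ) (Y : Set V) (k : ℕ) (v : V) : Prop :=
  ∀ (f : ℕ → ℕ) (F : Finset V), ∃ W, IsRecurrentWalk G U W ∧ W 0 = v ∧ (∀ n, W n ∈ Y) ∧
    (∀ n ≥ 1, W n ∉ F) ∧ ∀ n ≥ k, f n ≤ L (W n)

theorem exists_isGood {G : SimpleGraph V} {U : Set V} {L : V → ℕ} {Y : Set V}
    (hU : Cardinal.mk U < Cardinal.lift.{u} boundingNumber)
    (h : ∀ f : ℕ → ℕ, ∃ W, IsRecurrentWalk G U W ∧ (∀ n, W n ∈ Y) ∧ ∃ N, ∀ n ≥ N, f n ≤ L (W n)) :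
    ∃ k v, IsGood G U L Y k v := by
  by_contra! hcon
  unfold IsGood at hcon
  push Not at hcon
  choose f hf using hcon
  -- Summing over `k ≤ n` lets a single `g` eventually bound the counterexamples for every `k` at
  -- each vertex of `U`; a walk beating `g` then fails from its visit to `U` on.
  obtain ⟨g, hg⟩ := exists_dominates_of_lt_boundingNumber hU
    fun v n => ∑ k ∈ Finset.range (n + 1), f k v n
  obtain ⟨W, hW, hY, N, hN⟩ := h (majorant g)
  obtain ⟨m, -, hm⟩ := hW.recurrent 0
  obtain ⟨M, hM⟩ := dominates_iff.1 (hg _ hm)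
  obtain ⟨n, hn, hlt⟩ := hf (max M N) (W m) (fun n => W (n + m)) (hW.tail m) (by simp)
    (fun n => hY _)
  refine absurd hlt (not_lt.2 ?_)
  calc f (max M N) (W m) n ≤ ∑ k ∈ Finset.range (n + 1), f k (W m) n :=
        Finset.single_le_sum (f := fun k => f k (W m) n) (fun _ _ => Nat.zero_le _)
          (Finset.mem_range.2 (by omega))
    _ ≤ g n := hM n (by omega)
    _ ≤ majorant g n := le_majorant g n
    _ ≤ majorant g (n + m) := majorant_monotone g (by omega)
    _ ≤ L (W (n + m)) := hN _ (by omega)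

/-- Take `k` minimal. If `F` could not be avoided, a walk with large labels would meet `F` at some
`i` with `1 ≤ i < k`, and its tail would contradict that no vertex is good for `k - i`. -/
theorem exists_isFanGood {G : SimpleGraph V} {U : Set V} {L : V → ℕ} {Y : Set V}
    (hU : Cardinal.mk U < Cardinal.lift.{u} boundingNumber)
    (h : ∀ f : ℕ → ℕ, ∃ W, IsRecurrentWalk G U W ∧ (∀ n, W n ∈ Y) ∧ ∃ N, ∀ n ≥ N, f n ≤ L (W n)) :
    ∃ k, ∃ v ∈ Y, IsFanGood G U L Y k v := by
  classical
  have hex := exists_isGood hU h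
  obtain ⟨v, hv⟩ := Nat.find_spec hex
  have hmin := fun j hj w hw => Nat.find_min hex (m := j) hj ⟨w, hw⟩
  generalize Nat.find hex = k at hv hmin
  have hvY : v ∈ Y := by
    obtain ⟨W, -, rfl, hY, -⟩ := hv fun _ => 0
    exact hY 0
  refine ⟨k, v, hvY, ?_⟩
  by_contra hcon
  unfold IsFanGood at hcon
  push Not at hcon
  obtain ⟨f₀, F, hF⟩ := hcon
  have hbad : ∀ j w, ∃ f : ℕ → ℕ, j < k → ∀ W, IsRecurrentWalk G U W → W 0 = w →
      (∀ n, W n ∈ Y) → ∃ n ≥ j, L (W n) < f n := by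
    intro j w
    by_cases hj : j < k
    · have : ¬ IsGood G U L Y j w := hmin j hj w
      unfold IsGood at this
      push Not at this
      obtain ⟨f, hf⟩ := this
      exact ⟨f, fun _ => hf⟩
    · exact ⟨fun _ => 0, fun h => absurd h hj⟩
  choose f hf using hbad
  -- The term `F.sup L + 1` keeps `W` out of `F` from `k` on. For `j = k - i` the shift `k - j` is
  -- `i`, matching the tail at `i`.
  obtain ⟨W, hW, hW0, hY, hWf⟩ := hv fun n => f₀ n + (F.sup L + 1) +
    ∑ w ∈ F, ∑ j ∈ Finset.range k, f j w (n - (k - j))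
  obtain ⟨i, hi, hiF⟩ : ∃ i ≥ 1, W i ∈ F := by
    by_contra! hno
    obtain ⟨n, hn, hlt⟩ := hF W hW hW0 hY hno
    have := hWf n hn
    omega
  have hik : i < k := by
    by_contra hik
    have h1 := hWf i (by omega)
    have h2 : L (W i) ≤ F.sup L := Finset.le_sup hiF
    omega
  obtain ⟨n, hn, hlt⟩ := hf (k - i) (W i) (by omega) (fun n => W (n + i)) (hW.tail i) (by simp)
    (fun n => hY _)
  have h1 := hWf (n + i) (by omega)
  have h2 : f (k - i) (W i) n ≤ ∑ w ∈ F, ∑ j ∈ Finset.range k, f j w (n + i - (k - j)) := by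
    refine le_trans ?_ (Finset.single_le_sum
      (f := fun w => ∑ j ∈ Finset.range k, f j w (n + i - (k - j)))
      (fun _ _ => Nat.zero_le _) hiF)
    refine le_trans (le_of_eq ?_) (Finset.single_le_sum
      (f := fun j => f j (W i) (n + i - (k - j)))
      (fun _ _ => Nat.zero_le _) (Finset.mem_range.2 (show k - i < k by omega)))
    show _ = f (k - i) (W i) (n + i - (k - (k - i)))
    rw [show n + i - (k - (k - i)) = n by omega]
  omega

/-- Otherwise a finite set `A ℓ` blocks each length `ℓ`. Let `W` be a fast walk first entering `X`
at time `ℓ ≥ 1`. It meets `A ℓ`, and each such visit before `ℓ`, being outside `X`, forces a later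
visit to a finite closure of `A ℓ`. Large labels keep all these visits before `ℓ`, yet there are
more than `ℓ` of them. -/
theorem exists_fanWalk_length {G : SimpleGraph V} {U : Set V} {L : V → ℕ}
    (hU : Cardinal.mk U < Cardinal.lift.{u} boundingNumber) {X : Set V}
    (hX : ∀ v, v ∈ X ↔ ∃ k, IsFanGood G U L Set.univ k v) {v : V} (hv : v ∈ X) :
    ∃ ℓ, ∀ F : Finset V, ∃ p, IsFanWalk G X Set.univ F v ℓ p := by
  classical
  by_contra! hcon
  choose A hA using hcon
  obtain ⟨k₀, hk₀⟩ := (hX v).1 hv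
  -- Beating `fi` forces a walk into `X`; otherwise `exists_isFanGood` inside the complement would
  -- produce a member of `X` there.
  obtain ⟨fi, hfi⟩ : ∃ f : ℕ → ℕ, ∀ W, IsRecurrentWalk G U W → (∀ n, W n ∈ Xᶜ) →
      ∀ N, ∃ n ≥ N, L (W n) < f n := by
    by_contra! hcon
    obtain ⟨k, w, hw, hgood⟩ := exists_isFanGood hU hcon
    refine hw ((hX w).2 ⟨k, fun f F => ?_⟩)
    obtain ⟨W, h1, h2, -, h4⟩ := hgood f F
    exact ⟨W, h1, h2, fun _ => trivial, h4⟩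
  have hbad : ∀ k w, ∃ (f : ℕ → ℕ) (F : Finset V), w ∉ X → ∀ W, IsRecurrentWalk G U W →
      W 0 = w → (∀ n ≥ k, f n ≤ L (W n)) → ∃ n ≥ 1, W n ∈ F := by
    intro k w
    by_cases hw : w ∈ X
    · exact ⟨fun _ => 0, ∅, fun h => absurd hw h⟩
    · have : ¬ IsFanGood G U L Set.univ k w := fun h => hw ((hX w).2 ⟨k, h⟩)
      unfold IsFanGood at this
      push Not at this
      obtain ⟨f, F, hF⟩ := this
      refine ⟨f, F, fun _ W hW h0 hf => ?_⟩
      by_contra! hno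
      obtain ⟨n, hn, hlt⟩ := hF W hW h0 (fun _ => trivial) hno
      exact absurd (hf n hn) (not_le.2 hlt)
  choose f B hB using hbad
  let Φ : ℕ → ℕ → Finset V := fun ℓ n => Nat.rec (A ℓ)
    (fun _ C => C ∪ C.biUnion fun w => (Finset.range (ℓ + 1)).biUnion fun i => B i w) n
  have hΦsucc : ∀ ℓ n, Φ ℓ (n + 1) = Φ ℓ n ∪
    (Φ ℓ n).biUnion fun w => (Finset.range (ℓ + 1)).biUnion fun i => B i w := fun _ _ => rfl
  have hΦmono : ∀ ℓ, Monotone (Φ ℓ) := fun ℓ =>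
    monotone_nat_of_le_succ fun n => by rw [hΦsucc]; exact Finset.subset_union_left
  let g : ℕ → ℕ := fun n => majorant fi n + ∑ ℓ ∈ Finset.range (n + 1), ∑ w ∈ Φ ℓ ℓ,
    (L w + 1 + ∑ i ∈ Finset.range (ℓ + 1), majorant (f i w) n)
  -- Avoiding `A 0, …, A k₀` ensures `ℓ > k₀`, where the label bounds are in force.
  obtain ⟨W, hW, hW0, -, hWF, hWg⟩ := hk₀ g ((Finset.range (k₀ + 1)).biUnion A)
  have hle : ∀ ℓ w n, ℓ ≤ n → k₀ ≤ n → w ∈ Φ ℓ ℓ →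
      L w + 1 + ∑ i ∈ Finset.range (ℓ + 1), majorant (f i w) n ≤ L (W n) := by
    intro ℓ w n hn hk hw
    refine le_trans ?_ ((Nat.le_add_left _ _).trans (hWg n hk))
    refine le_trans ?_ (Finset.single_le_sum (f := fun ℓ => ∑ w ∈ Φ ℓ ℓ,
      (L w + 1 + ∑ i ∈ Finset.range (ℓ + 1), majorant (f i w) n))
      (fun _ _ => Nat.zero_le _) (Finset.mem_range.2 (show ℓ < n + 1 by omega)))
    exact Finset.single_le_sum
      (f := fun w => L w + 1 + ∑ i ∈ Finset.range (ℓ + 1), majorant (f i w) n)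
      (fun _ _ => Nat.zero_le _) hw
  have hex : ∃ ℓ, 1 ≤ ℓ ∧ W ℓ ∈ X := by
    by_contra! hno
    obtain ⟨n, hn, hlt⟩ := hfi (fun n => W (n + 1)) (hW.tail 1)
      (fun n => hno _ (by omega)) k₀
    have h1 : majorant fi (n + 1) ≤ L (W (n + 1)) :=
      (Nat.le_add_right _ _).trans (hWg (n + 1) (by omega))
    have h2 := (le_majorant fi n).trans (majorant_monotone fi (Nat.le_succ n))
    exact absurd (h2.trans h1) (not_le.2 hlt)
  obtain ⟨hℓ1, hℓX⟩ := Nat.find_spec hex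
  have hmin : ∀ j, 1 ≤ j → j < Nat.find hex → W j ∉ X := fun j h1 h2 h3 =>
    Nat.find_min hex h2 ⟨h1, h3⟩
  generalize Nat.find hex = ℓ at hℓ1 hℓX hmin
  obtain ⟨j, hj1, hjℓ, hjA⟩ : ∃ j, 1 ≤ j ∧ j ≤ ℓ ∧ W j ∈ A ℓ := by
    by_contra! hno
    exact hA ℓ W ⟨hℓ1, hW0, hℓX, fun i _ => hW.adj i, fun _ _ => trivial, hno⟩
  have hkℓ : k₀ < ℓ := by
    by_contra hk
    exact hWF j hj1 (Finset.mem_biUnion.2 ⟨ℓ, Finset.mem_range.2 (by omega), hjA⟩)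
  have hearly : ∀ j, W j ∈ Φ ℓ ℓ → j < ℓ := by
    intro j hj
    by_contra hjℓ
    have := hle ℓ (W j) j (by omega) (by omega) hj
    omega
  have key : ∀ n ≤ ℓ, ∃ j, n + 1 ≤ j ∧ j < ℓ ∧ W j ∈ Φ ℓ n := by
    intro n
    induction n with
    | zero => exact fun _ => ⟨j, hj1, hearly j (hΦmono ℓ (Nat.zero_le ℓ) hjA), hjA⟩
    | succ n ih =>
      intro hn
      obtain ⟨j, hj1, hjℓ, hjΦ⟩ := ih (by omega)
      have hjΦ' : W j ∈ Φ ℓ ℓ := hΦmono ℓ (by omega : n ≤ ℓ) hjΦ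
      obtain ⟨i, hi, hiB⟩ := hB (ℓ - j) (W j) (hmin j (by omega) hjℓ) (fun n => W (n + j))
        (hW.tail j) (by simp) (fun m hm => by
          have h1 := hle ℓ (W j) (m + j) (by omega) (by omega) hjΦ'
          have h2 := Finset.single_le_sum (f := fun i => majorant (f i (W j)) (m + j))
            (fun _ _ => Nat.zero_le _) (Finset.mem_range.2 (show ℓ - j < ℓ + 1 by omega))
          have h3 := (le_majorant (f (ℓ - j) (W j)) m).trans
            (majorant_monotone _ (Nat.le_add_right m j))
          exact h3.trans (h2.trans ((Nat.le_add_left _ _).trans h1)))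
      have hmem : W (i + j) ∈ Φ ℓ (n + 1) := by
        rw [hΦsucc]
        exact Finset.mem_union_right _ (Finset.mem_biUnion.2 ⟨_, hjΦ, Finset.mem_biUnion.2
          ⟨ℓ - j, Finset.mem_range.2 (by omega), hiB⟩⟩)
      exact ⟨i + j, by omega, hearly _ (hΦmono ℓ hn hmem), hmem⟩
  obtain ⟨j, h1, h2, -⟩ := key ℓ le_rfl
  omega

/-- Shortcutting leaves only finitely many lengths, so their obstructing sets can be avoided
together. -/
theorem exists_fanPath_length {G : SimpleGraph V} {X Z : Set V} {v : V} {ℓ : ℕ}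
    (h : ∀ F : Finset V, ∃ p, IsFanWalk G X Z F v ℓ p) :
    ∃ ℓ', ∀ F : Finset V, ∃ p, IsFanPath G X Z F v ℓ' p := by
  classical
  by_contra! hcon
  choose F hF using hcon
  obtain ⟨p, hp⟩ := h (insert v ((Finset.range (ℓ + 1)).biUnion F))
  obtain ⟨ℓ', hℓ', p', hp'⟩ := hp.exists_isFanPath (Finset.mem_insert_self _ _)
  refine hF ℓ' p' ⟨hp'.mono subset_rfl fun x hx => ?_, hp'.inj⟩
  exact Finset.mem_insert_of_mem
    (Finset.mem_biUnion.2 ⟨ℓ', Finset.mem_range.2 (by omega), hx⟩)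

/-- If the rays that meet a set of fewer than `𝔟` vertices infinitely often form a dominating
family, then the graph contains a uniform subdivision of `T_ω`. -/
theorem containsUniformSubdivision_of_recurrent {G : SimpleGraph V} {U : Set V} {L : V → ℕ}
    (hU : Cardinal.mk U < Cardinal.lift.{u} boundingNumber)
    (h : ∀ f : ℕ → ℕ, ∃ W, IsRecurrentWalk G U W ∧ ∃ N, ∀ n ≥ N, f n ≤ L (W n)) :
    ContainsUniformSubdivision G := by
  let X : Set V := {v | ∃ k, IsFanGood G U L Set.univ k v}
  have hX : X.Nonempty := by
    obtain ⟨k, v, -, hv⟩ := exists_isFanGood (Y := Set.univ) hU fun f => by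
      obtain ⟨W, h1, h2⟩ := h f
      exact ⟨W, h1, fun _ => trivial, h2⟩
    exact ⟨v, k, hv⟩
  have hex : ∀ v, ∃ ℓ, v ∈ X → ∀ F : Finset V, ∃ p, IsFanPath G X Set.univ F v ℓ p := by
    intro v
    by_cases hv : v ∈ X
    · obtain ⟨ℓ, hℓ⟩ := exists_fanWalk_length hU (fun _ => Iff.rfl) hv
      obtain ⟨ℓ', hℓ'⟩ := exists_fanPath_length hℓ
      exact ⟨ℓ', fun _ => hℓ'⟩
    · exact ⟨0, fun h => absurd h hv⟩
  choose ℓ hℓ using hex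
  obtain ⟨H, r, par, dep, μ, hS, -, -, hμ⟩ := exists_rootedSubdivision_of_fan hX
    (A := fun x => {ℓ x}) fun x hx F => ⟨ℓ x, rfl, hℓ x hx F⟩
  exact ⟨H, hS.isUniformSubdivision (fun x => ℓ x) hμ⟩

end

/-! ### Small transversals and necessity -/

/-- Either a family of countable sets contains `κ` disjoint members, or fewer than `κ` points
meet all its members. -/
theorem exists_disjoint_or_transversal {V : Type u} (C : Set (Set V))
    (hC : ∀ S ∈ C, S.Countable ∧ S.Nonempty) {κ : Cardinal.{0}} (hκ : Cardinal.aleph0 < κ) :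
    (∃ (ι : Type) (S : ι → Set V), Cardinal.mk ι = κ ∧ (∀ i, S i ∈ C) ∧
      Pairwise fun i j => Disjoint (S i) (S j)) ∨
    ∃ U : Set V, Cardinal.mk U < Cardinal.lift.{u} κ ∧ ∀ S ∈ C, (S ∩ U).Nonempty := by
  obtain ⟨M, hM⟩ := zorn_subset {M : Set (Set V) | M ⊆ C ∧ M.PairwiseDisjoint id} (by
    intro c hc hchain
    refine ⟨⋃₀ c, ⟨Set.sUnion_subset fun M hM => (hc hM).1, ?_⟩, fun M hM =>
      Set.subset_sUnion_of_mem hM⟩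
    exact (Set.pairwiseDisjoint_sUnion hchain.directedOn).2 fun M hM => (hc hM).2)
  by_cases hcard : Cardinal.lift.{u} κ ≤ Cardinal.mk M
  · left
    obtain ⟨ι, rfl⟩ : ∃ ι : Type, Cardinal.mk ι = κ := ⟨κ.out, Cardinal.mk_out κ⟩
    have h1 : Cardinal.lift.{u} (Cardinal.mk ι) ≤ Cardinal.lift.{0} (Cardinal.mk M) := by
      simpa using hcard
    obtain ⟨e⟩ := Cardinal.lift_mk_le'.1 h1
    exact ⟨ι, fun i => (e i).1, rfl, fun i => hM.prop.1 (e i).2, fun i j hij =>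
      hM.prop.2 (e i).2 (e j).2 fun h => hij (e.injective (Subtype.ext h))⟩
  · right
    rw [not_le] at hcard
    have hκ' : Cardinal.aleph0 < Cardinal.lift.{u} κ := by simpa using hκ
    -- The union of a maximal disjoint family meets every member of `C`; it is small because the
    -- members are countable and `κ` is uncountable.
    refine ⟨⋃₀ M, ?_, fun S hS => ?_⟩
    · refine (Cardinal.mk_sUnion_le M).trans_lt ?_
      have hsup : (⨆ S : M, Cardinal.mk S) ≤ Cardinal.aleph0 := ciSup_le' fun S =>
        Cardinal.mk_le_aleph0_iff.2 (hC S.1 (hM.prop.1 S.2)).1.to_subtype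
      exact Cardinal.mul_lt_of_lt hκ'.le hcard (hsup.trans_lt hκ')
    · by_contra hne
      rw [Set.not_nonempty_iff_eq_empty, ← Set.disjoint_iff_inter_eq_empty] at hne
      have hins : insert S M ∈ {M : Set (Set V) | M ⊆ C ∧ M.PairwiseDisjoint id} := by
        refine ⟨Set.insert_subset hS hM.prop.1, hM.prop.2.insert fun T hT _ => ?_⟩
        exact hne.mono_right (Set.subset_sUnion_of_mem hT)
      have hSM : S ∈ M := hM.le_of_ge hins (Set.subset_insert S M) (Set.mem_insert S M)
      obtain ⟨x, hx⟩ := (hC S hS).2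
      exact Set.disjoint_left.1 hne hx ⟨S, hSM, hx⟩

theorem IsRay.tail {V : Type u} {G : SimpleGraph V} {R : ℕ → V} (h : IsRay G R) (m : ℕ) :
    IsRay G fun n => R (n + m) := by
  refine ⟨fun i j hij => ?_, fun n => ?_⟩
  · have := h.1 hij
    omega
  · have := h.2 (n + m)
    rwa [show n + m + 1 = n + 1 + m by omega] at this

theorem IsDominating.exists_subgraphs {V : Type u} {G : SimpleGraph V} (hG : IsDominating G) :
    ContainsUniformSubdivision G ∨ ContainsDisjointSubdivisions G boundingNumber ∨
      ContainsDisjointRays G dominatingNumber := by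
  by_contra! hcon
  obtain ⟨hunif, hsub, hrays⟩ := hcon
  obtain ⟨L, hL⟩ := hG
  have hray : ∀ f : ℕ → ℕ, ∃ R, IsRay G R ∧ ∃ N, ∀ n ≥ N, f n ≤ L (R n) := by
    intro f
    obtain ⟨_, ⟨R, hR, rfl⟩, hd⟩ := hL f
    exact ⟨R, hR, dominates_iff.1 hd⟩
  obtain ⟨U, hU, hmeetU⟩ : ∃ U : Set V, Cardinal.mk U < Cardinal.lift.{u} boundingNumber ∧
      ∀ S ∈ {S | ∃ H : G.Subgraph, IsSubdivision H.coe ∧ H.verts.Countable ∧ H.verts = S},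
        (S ∩ U).Nonempty := by
    refine (exists_disjoint_or_transversal _ ?_ aleph0_lt_boundingNumber).resolve_left ?_
    · rintro _ ⟨H, hH, hc, rfl⟩
      obtain ⟨r, -⟩ := hH.exists_isBranch
      exact ⟨hc, r.1, r.2⟩
    · rintro ⟨ι, S, hι, hS, hdisj⟩
      choose H hH _ hHS using hS
      refine hsub ⟨ι, H, hι, hH, fun i j hij => ?_⟩
      show Disjoint (H i).verts (H j).verts
      rw [hHS, hHS]
      exact hdisj hij
  have hno : ∀ H : G.Subgraph, IsSubdivision H.coe → H.verts.Countable → ¬ H.verts ⊆ Uᶜ := by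
    intro H hH hc hsubset
    obtain ⟨x, hx, hxU⟩ := hmeetU _ ⟨H, hH, hc, rfl⟩
    exact hsubset hx hxU
  obtain ⟨D, hD, hmeetD⟩ : ∃ D : Set V, Cardinal.mk D < Cardinal.lift.{u} dominatingNumber ∧
      ∀ S ∈ {S | ∃ R, IsRay G R ∧ Set.range R = S}, (S ∩ D).Nonempty := by
    refine (exists_disjoint_or_transversal _ ?_ aleph0_lt_dominatingNumber).resolve_left ?_
    · rintro _ ⟨R, hR, rfl⟩
      exact ⟨Set.countable_range R, Set.range_nonempty R⟩
    · rintro ⟨ι, S, hι, hS, hdisj⟩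
      choose R hR hRS using hS
      refine hrays ⟨ι, R, hι, hR, fun i j hij => ?_⟩
      show Disjoint (Set.range (R i)) (Set.range (R j))
      rw [hRS, hRS]
      exact hdisj hij
  obtain ⟨h, hh⟩ := exists_undominated_of_no_subdivision hno hD (fun R hR _ => by
    obtain ⟨_, ⟨n, rfl⟩, hn⟩ := hmeetD _ ⟨R, hR, rfl⟩
    exact ⟨n, hn⟩) L
  refine hunif (containsUniformSubdivision_of_recurrent (L := L) hU fun f => ?_)
  -- If this ray met `U` only finitely often, a tail outside `U` would dominate `h`; the majorant
  -- absorbs the index shift.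
  obtain ⟨R, hR, N, hN⟩ := hray fun n => f n + majorant h n
  refine ⟨R, ⟨hR.2, ?_⟩, N, fun n hn => (Nat.le_add_right _ _).trans (hN n hn)⟩
  by_contra! hfin
  obtain ⟨m, hm⟩ := hfin
  refine hh _ (hR.tail m) (fun n => hm _ (by omega)) ⟨N, fun n hn => ?_⟩
  calc h n ≤ majorant h n := le_majorant h n
    _ ≤ majorant h (n + m) := majorant_monotone h (by omega)
    _ ≤ f (n + m) + majorant h (n + m) := Nat.le_add_left _ _
    _ ≤ L (R (n + m)) := hN _ (by omega)

end DominatingGraphs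

theorem mainTheorem1 {V : Type*} (G : SimpleGraph V) :
    DominatingGraphs.IsDominating G ↔
      DominatingGraphs.ContainsUniformSubdivision G ∨
      DominatingGraphs.ContainsDisjointSubdivisions G DominatingGraphs.boundingNumber ∨
      DominatingGraphs.ContainsDisjointRays G DominatingGraphs.dominatingNumber := by
  refine ⟨DominatingGraphs.IsDominating.exists_subgraphs, ?_⟩
  rintro (h | h | h)
  · exact .of_uniform h
  · exact .of_disjointSubdivisions h
  · exact .of_disjointRays h
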